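/- Let $\alpha\in(0,\tfrac12)$ be irrational with continued fraction expansion $\alpha=[0;a_1,a_2,\ldots]$ (so $a_1\ge 2$). Identify the circle with $[0,1)$ and let either $I_0=[0,1-\alpha)$, $I_1=[1-\alpha,1)$, or $I_0=(0,1-\alpha]$, $I_1=(1-\alpha,1]$ (where the point $1$ is the point $0$ of the circle). For a point $x$ of the circle let $s_{x,\alpha}$ be the infinite binary word whose $n$-th letter, $n\ge 0$, is $0$ if $\{x+n\alpha\}\in I_0$ and $1$ otherwise. Let $\mathcal L(\alpha)$ be the set of all finite factors of the words $s_{x,\alpha}$ (this set does not depend on the choice of endpoints), and for a finite word $u$ let $[u]$ be the set of points $x$ such that $s_{x,\alpha}$ begins with $u$. Let $\psi(x)=\frac12(x+1-\alpha)$ for $x\in(0,1)$, and let $\psi(0)=\frac12(1-\alpha)$ for the first choice of endpoints and $\psi(0)=1-\frac{\alpha}{2}$ for the second. A word $w$ is said to satisfy the square root condition if $w^2\in\mathcal L(\alpha)$ and $\psi([w^2])\subseteq[w]$. The standard words of slope $\alpha$ are the words $s_k$, $k\ge 0$, where $s_0=0$, $s_1=0^{a_1-1}1$ and $s_k=s_{k-1}^{a_k}s_{k-2}$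 for $k\ge2$. The semistandard words are the words $s_{k-1}^{\ell}s_{k-2}$ with $k\ge2$ and $1\le \ell<a_k$. **Theorem.** For either choice of endpoints, a primitive word $w$ (that is, $w=z^n$ only if $n=1$) satisfies the square root condition if and only if $w$ is one of the following: the reversal of a standard word, the reversal of a semistandard word, or a word obtained from the reversal of a standard word (of length at least $2$) by exchanging its first two letters. -/

import Mathlib

namespace SturmianSquareRoot

/-- Binary words: finite sequences over the alphabet `{0, 1}`. -/
abbrev Word := List (Fin 2)

/-- The power `z ^ n` of a finite word. -/
def wordPow (z : Word) (n : ℕ) : Word := (List.replicate n z).flatten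

/-- A word is primitive if it is a power `z ^ n` only for `n = 1`
(the empty word is not primitive, being its own second power). -/
def IsPrimitive (w : Word) : Prop := ∀ (z : Word) (n : ℕ), w = wordPow z n → n = 1

/-- The finite word `u` occurs in the infinite word `s` at position `i`. -/
def OccursAt (s : ℕ → Fin 2) (u : Word) (i : ℕ) : Prop :=
  ∀ (j : ℕ) (hj : j < u.length), s (i + j) = u[j]

/-- The two admissible choices of the endpoints of the coding intervals:
`I₀ = [0, 1 - α)`, `I₁ = [1 - α, 1)` or `I₀ = (0, 1 - α]`, `I₁ = (1 - α, 1]`. -/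
inductive EndpointChoice where
  | leftClosed
  | rightClosed

/-- The interval `I₀` of the circle, the circle being identified with `[0, 1)`. -/
def I₀ : EndpointChoice → ℝ → Set ℝ
  | .leftClosed, α => Set.Ico 0 (1 - α)
  | .rightClosed, α => Set.Ioc 0 (1 - α)

open Classical in
/-- The coding function `ν` on the circle `[0, 1)`: it is `0` on `I₀`, and `1` on the complement
`I₁` of `I₀` in the circle (for the second choice of endpoints, `I₁ = (1 - α, 1]` contains the
point `0`, which is the point `1` of the circle). -/
noncomputable def coding (c : EndpointChoice) (α x : ℝ) : Fin 2 :=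
  if x ∈ I₀ c α then 0 else 1

/-- The infinite word `s_{x,α}`, the coding of the orbit of `x` under the rotation by `α`. -/
noncomputable def rotationWord (c : EndpointChoice) (α x : ℝ) (n : ℕ) : Fin 2 :=
  coding c α (Int.fract (x + n * α))

/-- The language `L(α)`: the factors of the Sturmian words of slope `α`, that is, of the words
`s_{x,α}` for all points `x` of the circle and both choices of endpoints. -/
def language (α : ℝ) : Set Word :=
  {u | ∃ c : EndpointChoice, ∃ x ∈ Set.Ico (0 : ℝ) 1, ∃ i : ℕ,
    OccursAt (rotationWord c α x) u i}

/-- The interval `[u]`: the points `x` of the circle such that `s_{x,α}` begins with `u`. -/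
def cylinder (c : EndpointChoice) (α : ℝ) (u : Word) : Set ℝ :=
  {x ∈ Set.Ico (0 : ℝ) 1 | OccursAt (rotationWord c α x) u 0}

/-- The value of `ψ` at the point `0` of the circle. -/
noncomputable def psiZero : EndpointChoice → ℝ → ℝ
  | .leftClosed, α => (1 - α) / 2
  | .rightClosed, α => 1 - α / 2

/-- The map `ψ` of the circle `[0, 1)`. -/
noncomputable def psi (c : EndpointChoice) (α x : ℝ) : ℝ :=
  if x = 0 then psiZero c α else (x + 1 - α) / 2

/-- The square root condition: `w²` is a square in `L(α)` and `ψ([w²]) ⊆ [w]`. -/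
def SquareRootCondition (c : EndpointChoice) (α : ℝ) (w : Word) : Prop :=
  w ++ w ∈ language α ∧ psi c α '' cylinder c α (w ++ w) ⊆ cylinder c α w

/-- The partial quotient `a_k` of `α = [a₀; a₁, a₂, …]`, read off Mathlib's continued fraction
algorithm (whose `k`-th step never fails for an irrational number). -/
noncomputable def partialQuotient (α : ℝ) (k : ℕ) : ℕ :=
  (GenContFract.IntFractPair.stream α k).elim 0 fun p => p.b.toNat

/-- The standard words: `s₀ = 0`, `s₁ = 0^{a₁ - 1} 1` and `s_k = s_{k-1}^{a_k} s_{k-2}`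
for `k ≥ 2`. -/
noncomputable def standardWord (α : ℝ) : ℕ → Word
  | 0 => [0]
  | 1 => wordPow [0] (partialQuotient α 1 - 1) ++ [1]
  | k + 2 => wordPow (standardWord α (k + 1)) (partialQuotient α (k + 2)) ++ standardWord α k

/-- The word `s_{k,ℓ} = s_{k-1}^ℓ s_{k-2}`, for `k ≥ 2`. -/
noncomputable def semistandardWord (α : ℝ) (k l : ℕ) : Word :=
  wordPow (standardWord α (k - 1)) l ++ standardWord α (k - 2)

/-- The set of standard words of slope `α`. -/
def standardWords (α : ℝ) : Set Word := {w | ∃ k : ℕ, w = standardWord α k}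

/-- The set of semistandard words of slope `α`. -/
def semistandardWords (α : ℝ) : Set Word :=
  {w | ∃ k l : ℕ, 2 ≤ k ∧ 1 ≤ l ∧ l < partialQuotient α k ∧ w = semistandardWord α k l}

/-- Exchange of the first two letters. A word of length at most one is left unchanged; the only
such standard word is `s₀ = 0`. -/
def swapFirstTwo : Word → Word
  | a :: b :: u => b :: a :: u
  | u => u

end SturmianSquareRoot

namespace SturmianSquareRoot

/-! Lift the rotation to the line. A point x lies in `[w]` exactly when, for k ≤ n = |w|, the point
x + kα stays between h_k and h_k + 1, where h_k counts the letters 1 among the first k. So `[w]` is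
an interval with ends of the form i - kα. With d = nα - h_n, `[w²]` is the intersection of `[w]` and
`[w] - d`, and ψ(x) is the midpoint of x and 1 - α. This turns the condition into inequalities
between the ends and d that do not involve the choice of endpoints (`squareRootCondition_iff`).

The point 1 - α is never interior to `[w]`. If it had distance ε > 0 from `[w]`, the midpoint
condition would force |d| ≥ ε. Then `exists_divisor_of_gap` yields a proper divisor p of n with pα
so near an integer that w is a proper power (`eq_wordPow_of_abs_lt`). Hence for primitive w the
point 1 - α is an end of `[w]` (`isLeftWord_or_isRightWord`), w is determined by its side and its
length, and the condition becomes a one-sided best approximation property of n.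

If d lies on the side being compared, n is the denominator of a convergent or intermediate
convergent (`exists_eq_of_best_oneSided`), which gives reversed standard and semistandard words. If
d lies on the other side, `exists_divisor_of_best_opposite` and primitivity make n best on both
sides. This excludes intermediate convergents, and w is the coding on the wrong side of 1 - α, which
differs from a reversed standard word by its first two letters.

Conversely, `standardWord_side` computes the side and displacement of the reversed words, and the
best approximation properties of convergents give the condition. -/

/-! ### Letter counts and the coding as increments of floor or ceiling -/

/-- The number of letters `1` among the first `k` letters of a word. -/
def onesCount (w : Word) (k : ℕ) : ℤ := ((w.take k).count 1 : ℕ)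

@[simp] lemma onesCount_zero (w : Word) : onesCount w 0 = 0 := by simp [onesCount]

lemma onesCount_succ (w : Word) {k : ℕ} (hk : k < w.length) :
    onesCount w (k + 1) = onesCount w k + ((w[k]).val : ℤ) := by
  unfold onesCount
  rw [List.take_add_one, List.getElem?_eq_getElem hk]
  simp only [Option.toList_some, List.count_append, List.count_singleton]
  generalize w[k] = a
  fin_cases a <;> simp

lemma onesCount_append_of_le {u v : Word} {k : ℕ} (hk : k ≤ u.length) :
    onesCount (u ++ v) k = onesCount u k := by
  simp [onesCount, List.take_append_of_le_length hk]

lemma onesCount_append_add (u v : Word) (k : ℕ) :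
    onesCount (u ++ v) (u.length + k) = onesCount u u.length + onesCount v k := by
  simp [onesCount, List.take_length_add_append]

lemma eq_of_onesCount_eq {u v : Word} (hl : u.length = v.length)
    (h : ∀ k ≤ u.length, onesCount u k = onesCount v k) : u = v := by
  apply List.ext_getElem hl
  intro k hk hk'
  have h1 := h (k + 1) hk
  rw [onesCount_succ u hk, onesCount_succ v hk', h k hk.le] at h1
  apply Fin.ext
  omega

lemma occursAt_iff_onesCount {s : ℕ → Fin 2} {f : ℕ → ℤ}
    (hs : ∀ j, ((s j).val : ℤ) = f (j + 1) - f j) (w : Word) :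
    OccursAt s w 0 ↔ ∀ k ≤ w.length, f k = f 0 + onesCount w k := by
  constructor
  · intro h k
    induction k with
    | zero => simp
    | succ k ih =>
      intro hk
      have h1 := h k hk
      rw [onesCount_succ w hk, ← h1, Nat.zero_add, hs k, ih (by omega)]
      ring
  · intro h j hj
    have h1 := h (j + 1) hj
    rw [onesCount_succ w hj] at h1
    have h2 := hs j
    have h3 := h j hj.le
    rw [Nat.zero_add]
    apply Fin.ext
    omega

/-- A letter 1 marks the step at which the lifted orbit passes an integer. The other choice of
endpoints replaces floor by ceiling. -/
lemma coding_leftClosed {α : ℝ} (h0 : 0 < α) (h1 : α < 1) (x : ℝ) :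
    ((coding .leftClosed α (Int.fract x)).val : ℤ) = ⌊x + α⌋ - ⌊x⌋ := by
  have hx := Int.floor_add_fract x
  have hx0 := Int.fract_nonneg x
  have hx1 := Int.fract_lt_one x
  by_cases h : Int.fract x < 1 - α
  · have : ⌊x + α⌋ = ⌊x⌋ := by
      rw [Int.floor_eq_iff]; constructor <;> linarith
    rw [this, coding, if_pos ⟨hx0, h⟩]; simp
  · have : ⌊x + α⌋ = ⌊x⌋ + 1 := by
      rw [Int.floor_eq_iff]; push_cast; constructor <;> linarith
    rw [this, coding, if_neg (fun h' => h h'.2)]; simp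

lemma coding_rightClosed {α : ℝ} (h0 : 0 < α) (h1 : α < 1) (x : ℝ) :
    ((coding .rightClosed α (Int.fract x)).val : ℤ) = ⌈x + α⌉ - ⌈x⌉ := by
  have hx := Int.floor_add_fract x
  have hx0 := Int.fract_nonneg x
  have hx1 := Int.fract_lt_one x
  rcases hx0.eq_or_lt with hz | hpos
  · have e1 : ⌈x⌉ = ⌊x⌋ := by
      rw [Int.ceil_eq_iff]; constructor <;> linarith
    have e2 : ⌈x + α⌉ = ⌊x⌋ + 1 := by
      rw [Int.ceil_eq_iff]; push_cast; constructor <;> linarith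
    rw [e1, e2, coding, if_neg (fun h' => absurd h'.1 (by rw [← hz]; exact lt_irrefl _))]; simp
  · have e1 : ⌈x⌉ = ⌊x⌋ + 1 := by
      rw [Int.ceil_eq_iff]; push_cast; constructor <;> linarith
    by_cases h : Int.fract x ≤ 1 - α
    · have : ⌈x + α⌉ = ⌊x⌋ + 1 := by
        rw [Int.ceil_eq_iff]; push_cast; constructor <;> linarith
      rw [this, e1, coding, if_pos ⟨hpos, h⟩]; simp
    · have : ⌈x + α⌉ = ⌊x⌋ + 1 + 1 := by
        rw [Int.ceil_eq_iff]; push_cast; constructor <;> linarith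
      rw [this, e1, coding, if_neg (fun h' => h h'.2)]; simp

/-! ### Cylinders as intervals -/

/-- The left end of the interval of points whose coding begins with `w`. -/
noncomputable def lowerEnd (α : ℝ) (w : Word) : ℝ :=
  (Finset.range (w.length + 1)).sup' Finset.nonempty_range_add_one
    fun k => (onesCount w k : ℝ) - k * α

/-- The right end of the interval of points whose coding begins with `w`. -/
noncomputable def upperEnd (α : ℝ) (w : Word) : ℝ :=
  (Finset.range (w.length + 1)).inf' Finset.nonempty_range_add_one
    fun k => (onesCount w k : ℝ) + 1 - k * α

lemma lowerEnd_le_iff {α x : ℝ} {w : Word} :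
    lowerEnd α w ≤ x ↔ ∀ k ≤ w.length, (onesCount w k : ℝ) ≤ x + k * α := by
  simp [lowerEnd, Finset.sup'_le_iff]

lemma lowerEnd_lt_iff {α x : ℝ} {w : Word} :
    lowerEnd α w < x ↔ ∀ k ≤ w.length, (onesCount w k : ℝ) < x + k * α := by
  simp [lowerEnd, Finset.sup'_lt_iff, sub_lt_iff_lt_add]

lemma le_upperEnd_iff {α x : ℝ} {w : Word} :
    x ≤ upperEnd α w ↔ ∀ k ≤ w.length, x + k * α ≤ (onesCount w k : ℝ) + 1 := by
  simp [upperEnd, Finset.le_inf'_iff, le_sub_iff_add_le]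

lemma lt_upperEnd_iff {α x : ℝ} {w : Word} :
    x < upperEnd α w ↔ ∀ k ≤ w.length, x + k * α < (onesCount w k : ℝ) + 1 := by
  simp [upperEnd, Finset.lt_inf'_iff, lt_sub_iff_add_lt]

lemma exists_lowerEnd_eq (α : ℝ) (w : Word) :
    ∃ k ≤ w.length, lowerEnd α w = (onesCount w k : ℝ) - k * α := by
  obtain ⟨k, hk, h⟩ := Finset.exists_mem_eq_sup' (Finset.nonempty_range_add_one (n := w.length))
    fun k : ℕ => (onesCount w k : ℝ) - k * α
  exact ⟨k, by simpa [Nat.lt_succ_iff] using hk, h⟩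

lemma exists_upperEnd_eq (α : ℝ) (w : Word) :
    ∃ k ≤ w.length, upperEnd α w = (onesCount w k : ℝ) + 1 - k * α := by
  obtain ⟨k, hk, h⟩ := Finset.exists_mem_eq_inf' (Finset.nonempty_range_add_one (n := w.length))
    fun k : ℕ => (onesCount w k : ℝ) + 1 - k * α
  exact ⟨k, by simpa [Nat.lt_succ_iff] using hk, h⟩

lemma lowerEnd_nonneg (α : ℝ) (w : Word) : 0 ≤ lowerEnd α w := by
  simpa using lowerEnd_le_iff.1 (le_refl (lowerEnd α w)) 0 (Nat.zero_le _)

lemma upperEnd_le_one (α : ℝ) (w : Word) : upperEnd α w ≤ 1 := by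
  simpa using le_upperEnd_iff.1 (le_refl (upperEnd α w)) 0 (Nat.zero_le _)

lemma occursAt_leftClosed_iff {α : ℝ} (h0 : 0 < α) (h1 : α < 1) {x : ℝ}
    (hx : x ∈ Set.Ico (0 : ℝ) 1) (w : Word) :
    OccursAt (rotationWord .leftClosed α x) w 0 ↔
      x ∈ Set.Ico (lowerEnd α w) (upperEnd α w) := by
  rw [occursAt_iff_onesCount (f := fun k => ⌊x + k * α⌋), Set.mem_Ico, lowerEnd_le_iff,
    lt_upperEnd_iff, ← forall₂_and]
  · have : ⌊x⌋ = 0 := Int.floor_eq_zero_iff.2 hx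
    simp [this, Int.floor_eq_iff]
  · intro j
    rw [rotationWord, coding_leftClosed h0 h1]
    push_cast
    ring_nf

lemma occursAt_rightClosed_iff {α : ℝ} (h0 : 0 < α) (h1 : α < 1) {x : ℝ}
    (hx : x ∈ Set.Ioc (0 : ℝ) 1) (w : Word) :
    OccursAt (rotationWord .rightClosed α x) w 0 ↔
      x ∈ Set.Ioc (lowerEnd α w) (upperEnd α w) := by
  rw [occursAt_iff_onesCount (f := fun k => ⌈x + k * α⌉), Set.mem_Ioc, lowerEnd_lt_iff,
    le_upperEnd_iff, ← forall₂_and]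
  · have : ⌈x⌉ = 1 := by rw [Int.ceil_eq_iff]; simpa using hx
    simp [this, Int.ceil_eq_iff, add_comm]
  · intro j
    rw [rotationWord, coding_rightClosed h0 h1]
    push_cast
    ring_nf

/-- The representative in `(0, 1]` of a point of the circle `[0, 1)`. -/
noncomputable def upperRep (x : ℝ) : ℝ := if x = 0 then 1 else x

lemma upperRep_mem {x : ℝ} (hx : x ∈ Set.Ico (0 : ℝ) 1) : upperRep x ∈ Set.Ioc (0 : ℝ) 1 := by
  unfold upperRep
  split_ifs with h
  · simp
  · exact ⟨lt_of_le_of_ne hx.1 (Ne.symm h), hx.2.le⟩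

lemma rotationWord_upperRep (c : EndpointChoice) (α x : ℝ) :
    rotationWord c α (upperRep x) = rotationWord c α x := by
  unfold upperRep
  split_ifs with h
  · funext n
    rw [rotationWord, rotationWord, h, zero_add, add_comm, Int.fract_add_one]
  · rfl

lemma mem_cylinder_leftClosed {α : ℝ} (h0 : 0 < α) (h1 : α < 1) {x : ℝ} (w : Word) :
    x ∈ cylinder .leftClosed α w ↔ x ∈ Set.Ico (lowerEnd α w) (upperEnd α w) := by
  constructor
  · rintro ⟨hx, h⟩
    exact (occursAt_leftClosed_iff h0 h1 hx w).1 h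
  · intro h
    have hx : x ∈ Set.Ico (0 : ℝ) 1 :=
      ⟨(lowerEnd_nonneg α w).trans h.1, h.2.trans_le (upperEnd_le_one α w)⟩
    exact ⟨hx, (occursAt_leftClosed_iff h0 h1 hx w).2 h⟩

lemma mem_cylinder_rightClosed {α : ℝ} (h0 : 0 < α) (h1 : α < 1) {x : ℝ}
    (hx : x ∈ Set.Ico (0 : ℝ) 1) (w : Word) :
    x ∈ cylinder .rightClosed α w ↔
      upperRep x ∈ Set.Ioc (lowerEnd α w) (upperEnd α w) := by
  rw [← occursAt_rightClosed_iff h0 h1 (upperRep_mem hx), rotationWord_upperRep]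
  exact ⟨fun h => h.2, fun h => ⟨hx, h⟩⟩

/-- A factor at position i is a prefix at the rotated point, so only nonemptiness of a cylinder
matters; the lower end itself is a witness for the left-closed coding. -/
lemma mem_language_iff {α : ℝ} (h0 : 0 < α) (h1 : α < 1) (u : Word) :
    u ∈ language α ↔ lowerEnd α u < upperEnd α u := by
  constructor
  · rintro ⟨c, x, -, i, h⟩
    have hy : Int.fract (x + i * α) ∈ Set.Ico (0 : ℝ) 1 :=
      ⟨Int.fract_nonneg _, Int.fract_lt_one _⟩
    have hc : Int.fract (x + i * α) ∈ cylinder c α u := by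
      refine ⟨hy, fun j hj => ?_⟩
      rw [← h j hj, rotationWord, rotationWord]
      congr 1
      rw [Int.fract_eq_fract]
      exact ⟨-⌊x + i * α⌋, by rw [Int.fract]; push_cast; ring⟩
    cases c with
    | leftClosed =>
      have := (mem_cylinder_leftClosed h0 h1 u).1 hc
      exact this.1.trans_lt this.2
    | rightClosed =>
      have := (mem_cylinder_rightClosed h0 h1 hy u).1 hc
      exact this.1.trans_le this.2
  · intro h
    have := (mem_cylinder_leftClosed h0 h1 u).2 ⟨le_refl _, h⟩
    exact ⟨.leftClosed, _, this.1, 0, this.2⟩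

/-! ### Squares and the square root condition as inequalities -/

/-- The displacement of the circle under `|w|` rotations, measured by lifting along `w`. -/
noncomputable def displacement (α : ℝ) (w : Word) : ℝ :=
  w.length * α - onesCount w w.length

lemma forall_le_length_append {u v : Word} {P : ℕ → Prop} :
    (∀ k ≤ (u ++ v).length, P k) ↔
      (∀ k ≤ u.length, P k) ∧ ∀ k ≤ v.length, P (u.length + k) := by
  rw [List.length_append]
  constructor
  · intro h
    exact ⟨fun k hk => h k (by omega), fun k hk => h _ (by omega)⟩
  · rintro ⟨h1, h2⟩ k hk
    rcases le_total k u.length with h | h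
    · exact h1 k h
    · obtain ⟨t, rfl⟩ := Nat.exists_eq_add_of_le h
      exact h2 t (by omega)

/-- Reading the second copy of `w` from x is reading `w` from x + d, where d is the displacement. -/
lemma lowerEnd_square (α : ℝ) (w : Word) :
    lowerEnd α (w ++ w) = max (lowerEnd α w) (lowerEnd α w - displacement α w) := by
  apply eq_of_forall_ge_iff
  intro x
  rw [max_le_iff, sub_le_iff_le_add, lowerEnd_le_iff, lowerEnd_le_iff, lowerEnd_le_iff,
    forall_le_length_append]
  apply and_congr
  · exact forall₂_congr fun k hk => by rw [onesCount_append_of_le hk]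
  · refine forall₂_congr fun k hk => ?_
    rw [onesCount_append_add, displacement]
    push_cast
    constructor <;> intro h <;> linarith

lemma upperEnd_square (α : ℝ) (w : Word) :
    upperEnd α (w ++ w) = min (upperEnd α w) (upperEnd α w - displacement α w) := by
  apply eq_of_forall_le_iff
  intro x
  rw [le_min_iff, le_sub_iff_add_le, le_upperEnd_iff, le_upperEnd_iff, le_upperEnd_iff,
    forall_le_length_append]
  apply and_congr
  · exact forall₂_congr fun k hk => by rw [onesCount_append_of_le hk]
  · refine forall₂_congr fun k hk => ?_
    rw [onesCount_append_add, displacement]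
    push_cast
    constructor <;> intro h <;> linarith

lemma psi_leftClosed (α x : ℝ) : psi .leftClosed α x = (x + (1 - α)) / 2 := by
  unfold psi psiZero
  split_ifs with h
  · rw [h]; ring
  · ring

lemma psi_rightClosed (α x : ℝ) : psi .rightClosed α x = (upperRep x + (1 - α)) / 2 := by
  unfold psi psiZero upperRep
  split_ifs with h <;> ring

lemma squareRootCondition_iff_ends {α : ℝ} (h0 : 0 < α) (h1 : α < 1) (c : EndpointChoice)
    (w : Word) :
    SquareRootCondition c α w ↔
      lowerEnd α (w ++ w) < upperEnd α (w ++ w) ∧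
        lowerEnd α w ≤ (lowerEnd α (w ++ w) + (1 - α)) / 2 ∧
        (upperEnd α (w ++ w) + (1 - α)) / 2 ≤ upperEnd α w := by
  rw [SquareRootCondition, mem_language_iff h0 h1]
  refine and_congr_right fun hab => ?_
  have ha0 := lowerEnd_nonneg α (w ++ w)
  have hb1 := upperEnd_le_one α (w ++ w)
  rw [Set.image_subset_iff]
  set a := lowerEnd α (w ++ w)
  set b := upperEnd α (w ++ w)
  cases c with
  | leftClosed =>
    constructor
    · intro h
      have key : ∀ x, a ≤ x → x < b →
          lowerEnd α w ≤ (x + (1 - α)) / 2 ∧ (x + (1 - α)) / 2 < upperEnd α w := by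
        intro x hxa hxb
        have := h ((mem_cylinder_leftClosed h0 h1 (w ++ w)).2 ⟨hxa, hxb⟩)
        rw [Set.mem_preimage, psi_leftClosed, mem_cylinder_leftClosed h0 h1] at this
        exact this
      refine ⟨(key a le_rfl hab).1, ?_⟩
      by_contra! hlt
      -- The end b may be missing from the cylinder, so the test point is taken inside; `2 *
      -- upperEnd α w - (1 - α)` is what ψ sends to the end of `[w]`.
      have := (key (max a (2 * upperEnd α w - (1 - α))) (le_max_left _ _)
        (max_lt hab (by linarith))).2
      have := le_max_right a (2 * upperEnd α w - (1 - α))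
      linarith
    · rintro ⟨hA, hB⟩ x hx
      have hx := (mem_cylinder_leftClosed h0 h1 (w ++ w)).1 hx
      rw [Set.mem_preimage, psi_leftClosed, mem_cylinder_leftClosed h0 h1]
      have hx1 : a ≤ x := hx.1
      have hx2 : x < b := hx.2
      constructor <;> linarith
  | rightClosed =>
    have hpsi : ∀ x ∈ Set.Ico (0 : ℝ) 1, psi .rightClosed α x ∈ Set.Ico (0 : ℝ) 1 ∧
        upperRep (psi .rightClosed α x) = (upperRep x + (1 - α)) / 2 := by
      intro x hx
      have := upperRep_mem hx
      rw [psi_rightClosed]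
      have hpos : 0 < (upperRep x + (1 - α)) / 2 := by linarith [this.1]
      refine ⟨⟨hpos.le, by linarith [this.2]⟩, ?_⟩
      generalize (upperRep x + (1 - α)) / 2 = z at hpos
      simp [upperRep, hpos.ne']
    constructor
    · intro h
      have key : ∀ x, a < x → x ≤ b →
          lowerEnd α w < (x + (1 - α)) / 2 ∧ (x + (1 - α)) / 2 ≤ upperEnd α w := by
        intro x hxa hxb
        obtain ⟨x', hx', hxx⟩ : ∃ x' ∈ Set.Ico (0 : ℝ) 1, upperRep x' = x := by
          rcases (hxb.trans hb1).eq_or_lt with h | h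
          · exact ⟨0, by simp, by simp [upperRep, h]⟩
          · have : 0 < x := by linarith
            exact ⟨x, ⟨this.le, h⟩, by simp [upperRep, this.ne']⟩
        have := h ((mem_cylinder_rightClosed h0 h1 hx' (w ++ w)).2 (by
          rw [hxx]; exact ⟨hxa, hxb⟩))
        rw [Set.mem_preimage, mem_cylinder_rightClosed h0 h1 (hpsi x' hx').1,
          (hpsi x' hx').2, hxx] at this
        exact this
      refine ⟨?_, (key b hab le_rfl).2⟩
      by_contra! hlt
      have := (key (min b (2 * lowerEnd α w - (1 - α)))
        (lt_min hab (by linarith)) (min_le_left _ _)).1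
      have := min_le_right b (2 * lowerEnd α w - (1 - α))
      linarith
    · rintro ⟨hA, hB⟩ x hx
      have hx' := hx.1
      have hx := (mem_cylinder_rightClosed h0 h1 hx' (w ++ w)).1 hx
      rw [Set.mem_preimage, mem_cylinder_rightClosed h0 h1 (hpsi x hx').1, (hpsi x hx').2]
      have hx1 : a < upperRep x := hx.1
      have hx2 : upperRep x ≤ b := hx.2
      constructor <;> linarith

/-- The square root condition in terms of the interval of `w`; it does not depend on the choice of
endpoints. -/
lemma squareRootCondition_iff {α : ℝ} (h0 : 0 < α) (h1 : α < 1) (c : EndpointChoice)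
    (w : Word) :
    SquareRootCondition c α w ↔
      |displacement α w| < upperEnd α w - lowerEnd α w ∧
        lowerEnd α w ≤ (max (lowerEnd α w) (lowerEnd α w - displacement α w) + (1 - α)) / 2 ∧
        (min (upperEnd α w) (upperEnd α w - displacement α w) + (1 - α)) / 2 ≤ upperEnd α w := by
  rw [squareRootCondition_iff_ends h0 h1, lowerEnd_square, upperEnd_square]
  refine and_congr_left fun _ => ?_
  rw [abs_lt, max_lt_iff, lt_min_iff, lt_min_iff]
  constructor
  · rintro ⟨⟨h1, h2⟩, h3, h4⟩
    constructor <;> linarith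
  · rintro ⟨h1, h2⟩
    refine ⟨⟨?_, ?_⟩, ?_, ?_⟩
    · by_contra h; rcases le_total 0 (displacement α w) with h' | h' <;> linarith
    · linarith
    · linarith
    · by_contra h; rcases le_total 0 (displacement α w) with h' | h' <;> linarith

/-! ### Gaps between orbit points, periods and divisors -/

/-- Shifted by kα, the interval lies between two consecutive integers. -/
lemma notMem_interval {α : ℝ} (w : Word) {k : ℕ} (hk : k ≤ w.length) (i : ℤ) :
    (i : ℝ) - k * α ≤ lowerEnd α w ∨ upperEnd α w ≤ (i : ℝ) - k * α := by
  have hA := lowerEnd_le_iff.1 (le_refl (lowerEnd α w)) k hk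
  have hB := le_upperEnd_iff.1 (le_refl (upperEnd α w)) k hk
  rcases le_or_gt i (onesCount w k) with h | h
  · left
    have : (i : ℝ) ≤ onesCount w k := by exact_mod_cast h
    linarith
  · right
    have : (onesCount w k : ℝ) + 1 ≤ i := by exact_mod_cast h
    linarith

lemma eq_wordPow_of_period {t p : ℕ} : ∀ {w : Word}, w.length = t * p →
    (∀ k, ∀ h : k + p < w.length, w[k + p] = w[k]) → w = wordPow (w.take p) t := by
  induction t with
  | zero =>
    intro w hl _
    have : w = [] := List.eq_nil_of_length_eq_zero (by simpa using hl)
    simp [wordPow, this]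
  | succ t ih =>
    intro w hl hper
    have hl' : (w.drop p).length = t * p := by
      rw [List.length_drop, hl, Nat.succ_mul]; omega
    have := ih hl' (fun k h => by
      rw [List.length_drop] at h
      simp only [List.getElem_drop]
      have := hper (p + k) (by omega)
      simpa [add_assoc] using this)
    have hpow : wordPow (w.take p) (t + 1) = w.take p ++ wordPow (w.take p) t := by
      simp [wordPow, List.replicate_succ]
    rw [hpow]
    conv_lhs => rw [← List.take_append_drop p w, this]
    rcases Nat.eq_zero_or_pos t with rfl | ht
    · simp [wordPow]
    · have hp : p ≤ t * p := Nat.le_mul_of_pos_left p ht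
      have : (w.drop p).take p = w.take p := by
        apply List.ext_getElem
        · rw [List.length_take, List.length_take, hl', hl, Nat.succ_mul]; omega
        · intro k h1 h2
          simp only [List.getElem_take, List.getElem_drop]
          rw [List.length_take] at h1 h2
          have := hper k (by rw [hl, Nat.succ_mul]; omega)
          simpa [add_comm] using this
      rw [this]

/-- Some x and x + (pα - P) both lie in the interval of `w`, so they have the same first |w|
letters. The second orbit is the first one advanced by p steps, so `w` has period p. -/
lemma eq_wordPow_of_abs_lt {α : ℝ} {w : Word} {t p : ℕ} {P : ℤ} (hl : w.length = t * p)
    (h : |p * α - P| < upperEnd α w - lowerEnd α w) : w = wordPow (w.take p) t := by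
  set e := p * α - P with he
  obtain ⟨h1, h2⟩ := abs_lt.1 h
  have h3 : lowerEnd α w < upperEnd α w := by linarith [abs_nonneg e]
  obtain ⟨x, hx1, hx2⟩ : ∃ x, max (lowerEnd α w) (lowerEnd α w - e) < x ∧
      x < min (upperEnd α w) (upperEnd α w - e) :=
    exists_between (max_lt (lt_min h3 (by linarith)) (lt_min (by linarith) (by linarith)))
  obtain ⟨hx1, hx3⟩ := max_lt_iff.1 hx1
  obtain ⟨hx2, hx4⟩ := lt_min_iff.1 hx2
  have f1 : ∀ k ≤ w.length, ⌊x + k * α⌋ = onesCount w k := fun k hk =>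
    Int.floor_eq_iff.2 ⟨lowerEnd_le_iff.1 hx1.le k hk, lt_upperEnd_iff.1 hx2 k hk⟩
  have f2 : ∀ k ≤ w.length, ⌊x + e + k * α⌋ = onesCount w k := fun k hk =>
    Int.floor_eq_iff.2 ⟨lowerEnd_le_iff.1 (show lowerEnd α w ≤ x + e by linarith) k hk,
      lt_upperEnd_iff.1 (show x + e < upperEnd α w by linarith) k hk⟩
  have key : ∀ k, k + p ≤ w.length → onesCount w (k + p) = onesCount w k + P := by
    intro k hk
    rw [← f1 _ hk, ← f2 k (by omega), ← Int.floor_add_intCast]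
    congr 1
    rw [he]; push_cast; ring
  apply eq_wordPow_of_period hl
  intro k hk
  have a1 := key (k + 1) (by omega)
  have a2 := key k hk.le
  rw [show k + 1 + p = k + p + 1 by ring, onesCount_succ w hk, onesCount_succ w (by omega)] at a1
  apply Fin.ext
  omega

lemma intCast_mul_sub_ne_zero {α : ℝ} (hα : Irrational α) {j : ℤ} (hj : j ≠ 0) (i : ℤ) :
    (j : ℝ) * α - i ≠ 0 := by
  intro h
  exact (hα.intCast_mul hj).ne_int i (sub_eq_zero.1 h)

lemma natCast_mul_sub_ne_zero {α : ℝ} (hα : Irrational α) {j : ℕ} (hj : j ≠ 0) (i : ℤ) :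
    (j : ℝ) * α - i ≠ 0 := by
  simpa using intCast_mul_sub_ne_zero hα (Int.natCast_ne_zero.2 hj) i

/-- If an interval `(A, B)` free of the points `-kα` with `k ≤ n` is longer than the displacement
`nα - H` and its right end lies to the left of `-α`, but at most at the distance `nα - H`, then `n`
is a proper multiple of a number with a small displacement. -/
lemma exists_divisor_of_gap {α A B : ℝ} (hα : Irrational α) {n m : ℕ} {Y H M : ℤ}
    (hgap : ∀ k ≤ n, ∀ i : ℤ, (i : ℝ) - k * α ≤ A ∨ B ≤ i - k * α) (hm : 1 ≤ m) (hmn : m < n)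
    (hB : B = Y - α - (m * α - M)) (h0 : 0 < m * α - M) (h1 : m * α - M ≤ n * α - H)
    (h2 : n * α - H < B - A) :
    ∃ (t p : ℕ) (P : ℤ), n = t * p ∧ 2 ≤ t ∧ |p * α - P| < B - A := by
  obtain ⟨p, rfl⟩ := Nat.exists_eq_add_of_le hmn.le
  have hp : 0 < p := by omega
  set P : ℤ := H - M with hP
  have hPr : (P : ℝ) = H - M := by rw [hP]; push_cast; ring
  push_cast at h1 h2
  have hep : 0 < p * α - P :=
    lt_of_le_of_ne (by rw [hPr]; linarith) (natCast_mul_sub_ne_zero hα hp.ne' P).symm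
  -- Otherwise B - (mα - M), an orbit point of index 2m + 1 ≤ n, would lie in (A, B).
  have hpm : p ≤ m := by
    by_contra! h
    rcases hgap (2 * m + 1) (by omega) (Y + 2 * M) with h' | h' <;> push_cast at h' <;> linarith
  -- Otherwise Y - α - (pα - P), of index p + 1, would lie in (A, B).
  have hepm : p * α - P ≤ m * α - M := by
    by_contra! h
    rcases hgap (p + 1) (by omega) (Y + P) with h' | h' <;> push_cast at h' <;> linarith
  -- Here i is m / p rounded up.
  obtain ⟨i, r, hir, hr⟩ : ∃ i r : ℕ, i * p = m + r ∧ r < p := by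
    have h1 := Nat.div_add_mod (m + p - 1) p
    have h2 := Nat.mod_lt (m + p - 1) hp
    refine ⟨(m + p - 1) / p, p - 1 - (m + p - 1) % p, ?_, by omega⟩
    rw [mul_comm]; omega
  have hirR : (i : ℝ) * p = m + r := by exact_mod_cast hir
  -- The points Y - α - s(pα - P) start to the right of B and move left in steps shorter than B - A,
  -- so they cannot pass B without landing in the gap.
  have hmul : ∀ s : ℕ, s ≤ i → s * (p * α - P) ≤ m * α - M := by
    intro s
    induction s with
    | zero => intro _; simpa using h0.le
    | succ s ih =>
      intro hs
      have ih := ih (by omega)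
      have hle : (s + 1) * p ≤ i * p := Nat.mul_le_mul_right p hs
      rcases hgap ((s + 1) * p + 1) (by omega) (Y + (s + 1) * P) with h' | h' <;>
        push_cast at h' ⊢ <;> linarith
  have hi := hmul i le_rfl
  have hiα : (i : ℝ) * (p * α) = m * α + r * α := by rw [← mul_assoc, hirR]; ring
  -- If the last of these points were strictly to the right of B, its reflection about B, of index m
  -- + 1 - r, would lie in (A, B).
  have hi0 : m * α - M - i * (p * α - P) = 0 := by
    by_contra hne
    have hpos : 0 < m * α - M - i * (p * α - P) := lt_of_le_of_ne (by linarith) (Ne.symm hne)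
    have hnn : (0 : ℝ) ≤ i * (p * α - P) := by positivity
    have hk : ((m + 1 - r : ℕ) : ℝ) = m + 1 - r := by
      rw [Nat.cast_sub (by omega)]; push_cast; ring
    have hmm : (m : ℝ) * α - M - i * (p * α - P) = i * P - M - r * α := by linarith
    rcases hgap (m + 1 + r) (by omega) (Y + i * P) with h' | h' <;> push_cast at h'
    · rcases hgap (m + 1 - r) (by omega) (Y + 2 * M - i * P) with h'' | h'' <;>
        rw [hk] at h'' <;> push_cast at h'' <;> linarith
    · rcases hgap (m + 1 - r) (by omega) (Y + 2 * M - i * P) with h'' | h'' <;>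
        rw [hk] at h'' <;> push_cast at h'' <;> linarith
  have hr0 : r = 0 := by
    by_contra hne
    apply natCast_mul_sub_ne_zero hα hne (i * P - M)
    push_cast
    linarith
  subst hr0
  have hi1 : 1 ≤ i := by
    rcases Nat.eq_zero_or_pos i with rfl | h
    · simp at hir; omega
    · exact h
  refine ⟨i + 1, p, P, by rw [add_mul, hir]; omega, by omega, ?_⟩
  rw [abs_of_pos hep, hPr]
  linarith

/-- If the positive distance `H - nα` is smaller than all positive distances `jα - i` with
`0 < j < n`, but not smaller than all positive distances `i - jα`, then `n` is a proper multiple of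
a number with a small displacement. -/
lemma exists_divisor_of_best_opposite {α : ℝ} (hα : Irrational α) {n : ℕ} {H : ℤ}
    (hbest : ∀ j : ℕ, 0 < j → j < n → ∀ i : ℤ, 0 < j * α - i → H - n * α < j * α - i)
    (hex : ∃ j : ℕ, 0 < j ∧ j < n ∧ ∃ i : ℤ, 0 < i - j * α ∧ i - j * α ≤ H - n * α) :
    ∃ (t p : ℕ) (P : ℤ), n = t * p ∧ 2 ≤ t ∧ |p * α - P| ≤ H - n * α := by
  obtain ⟨j₀, hj₀, hj₀n, i₀, hi₀, hi₀H⟩ := hex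
  have hle : ∀ (j : ℕ) (i : ℤ), 0 < i - j * α → ((⌊j * α⌋ + 1 : ℤ) : ℝ) - j * α ≤ i - j * α := by
    intro j i hi
    have : ⌊j * α⌋ < i := Int.floor_lt.2 (by linarith)
    have : ((⌊j * α⌋ + 1 : ℤ) : ℝ) ≤ i := by exact_mod_cast this
    linarith
  -- Take p realizing the least positive distance i - jα over 0 < j < n.
  obtain ⟨p, hp, hmin⟩ := Finset.exists_min_image (Finset.Ioo 0 n)
    (fun j : ℕ => ((⌊j * α⌋ + 1 : ℤ) : ℝ) - j * α) ⟨j₀, by simp [hj₀, hj₀n]⟩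
  rw [Finset.mem_Ioo] at hp
  set P : ℤ := ⌊p * α⌋ + 1 with hP
  have hd : 0 < (P : ℝ) - p * α := by
    rw [hP]; push_cast; linarith [Int.lt_floor_add_one (p * α)]
  have hmin' : ∀ j : ℕ, 0 < j → j < n → ∀ i : ℤ, 0 < i - j * α → (P : ℝ) - p * α ≤ i - j * α :=
    fun j hj hjn i hi => (hmin j (Finset.mem_Ioo.2 ⟨hj, hjn⟩)).trans (hle j i hi)
  have hdH : (P : ℝ) - p * α ≤ H - n * α := (hmin' j₀ hj₀ hj₀n i₀ hi₀).trans hi₀H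
  -- Each subtraction of p from n leaves a distance that is positive by irrationality, hence at
  -- least P - pα by minimality, so one more subtraction is possible.
  have hstep : ∀ s : ℕ, s * p ≤ n → 0 ≤ H - n * α - s * (P - p * α) := by
    intro s
    induction s with
    | zero => intro _; simpa using hd.le.trans hdH
    | succ s ih =>
      intro hs
      have hs' : s * p < n := by rw [add_mul] at hs; omega
      have ih := ih hs'.le
      rcases Nat.eq_zero_or_pos s with rfl | hs0
      · push_cast; linarith
      · have hc : ((n - s * p : ℕ) : ℝ) = n - s * p := by
          rw [Nat.cast_sub hs'.le]; push_cast; ring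
        have hsp : 0 < s * p := Nat.mul_pos hs0 hp.1
        have hne := natCast_mul_sub_ne_zero hα (j := n - s * p) (by omega) (H - s * P)
        have := hmin' (n - s * p) (by omega) (by omega) (H - s * P) (by
          refine lt_of_le_of_ne ?_ (fun h => hne (by linarith))
          rw [hc]; push_cast; linarith)
        rw [hc] at this
        push_cast at this ⊢
        linarith
  have hdm := Nat.div_add_mod' n p
  have hr := Nat.mod_lt n hp.1
  set s := n / p
  set r := n % p
  have hs1 : 1 ≤ s := (Nat.one_le_div_iff hp.1).2 hp.2.le
  have hdmR : (n : ℝ) = s * p + r := by exact_mod_cast hdm.symm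
  -- A nonzero remainder r would still have distance at least P - pα, so p - r would lie on the
  -- opposite side at a distance below H - nα, against `hbest`.
  have hrz : r = 0 := by
    by_contra hne
    have hsp : 0 < s * p := Nat.mul_pos hs1 hp.1
    have h1 := hstep s (by omega)
    have h2 := hmin' r (by omega) (by omega) (H - s * P) (by
      have := natCast_mul_sub_ne_zero hα hne (H - s * P)
      refine lt_of_le_of_ne ?_ (fun h => this (by linarith))
      rw [hdmR] at h1; push_cast; linarith)
    have hc : ((p - r : ℕ) : ℝ) = p - r := by rw [Nat.cast_sub hr.le]
    have hne2 := natCast_mul_sub_ne_zero hα (j := p - r) (by omega) (P - (H - s * P))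
    have h3 := hbest (p - r) (by omega) (by omega) (P - (H - s * P)) (by
      refine lt_of_le_of_ne ?_ hne2.symm
      rw [hc]; push_cast at h2 ⊢; linarith)
    rw [hc] at h3
    rw [hdmR] at h3 h1
    have : (0 : ℝ) ≤ (s : ℝ) * (P - p * α) := by positivity
    have hs1R : (1 : ℝ) ≤ s := by exact_mod_cast hs1
    have := mul_le_mul_of_nonneg_right hs1R hd.le
    push_cast at h3 h2
    linarith
  refine ⟨s, p, P, by omega, ?_, ?_⟩
  · by_contra h
    have : s = 1 := by omega
    rw [this] at hdm; omega
  · rw [abs_sub_comm, abs_of_pos hd]; exact hdH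

/-! ### Continued fractions and best approximations -/

/-- The remainder of the `k`-th step of the continued fraction algorithm. -/
noncomputable def remainder (α : ℝ) (k : ℕ) : ℝ :=
  (GenContFract.IntFractPair.stream α k).elim 0 fun p => p.fr

section Remainder

variable {α : ℝ}

lemma exists_stream_eq (hα : Irrational α) (k : ℕ) :
    ∃ p, GenContFract.IntFractPair.stream α k = some p ∧ Irrational p.fr ∧
      0 < p.fr ∧ p.fr < 1 := by
  have key : ∀ x : ℝ, Irrational x → Irrational (Int.fract x) ∧ 0 < Int.fract x ∧
      Int.fract x < 1 := by
    intro x hx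
    have hf : Irrational (Int.fract x) := hx.sub_intCast _
    exact ⟨hf, lt_of_le_of_ne (Int.fract_nonneg x) hf.ne_zero.symm, Int.fract_lt_one x⟩
  induction k with
  | zero => exact ⟨_, GenContFract.IntFractPair.stream_zero α, key α hα⟩
  | succ k ih =>
    obtain ⟨p, hp, h1, -, -⟩ := ih
    exact ⟨_, GenContFract.IntFractPair.stream_succ_of_some hp h1.ne_zero, key _ h1.inv⟩

lemma remainder_zero (h0 : 0 < α) (h1 : α < 1) : remainder α 0 = α := by
  rw [remainder, GenContFract.IntFractPair.stream_zero]
  exact Int.fract_eq_self.2 ⟨h0.le, h1⟩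

lemma remainder_pos (hα : Irrational α) (k : ℕ) : 0 < remainder α k := by
  obtain ⟨p, hp, -, h, -⟩ := exists_stream_eq hα k
  rw [remainder, hp]; exact h

lemma remainder_lt_one (hα : Irrational α) (k : ℕ) : remainder α k < 1 := by
  obtain ⟨p, hp, -, -, h⟩ := exists_stream_eq hα k
  rw [remainder, hp]; exact h

lemma partialQuotient_add_remainder (hα : Irrational α) (k : ℕ) :
    partialQuotient α (k + 1) + remainder α (k + 1) = (remainder α k)⁻¹ := by
  obtain ⟨p, hp, h1, h0, -⟩ := exists_stream_eq hα k
  rw [partialQuotient, remainder, remainder, hp,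
    GenContFract.IntFractPair.stream_succ_of_some hp h1.ne_zero]
  simp only [Option.elim, GenContFract.IntFractPair.of]
  have : 0 ≤ ⌊p.fr⁻¹⌋ := Int.floor_nonneg.2 (inv_pos.2 h0).le
  rw [← Int.cast_natCast, Int.toNat_of_nonneg this]
  exact Int.floor_add_fract _

lemma one_le_partialQuotient (hα : Irrational α) (k : ℕ) : 1 ≤ partialQuotient α (k + 1) := by
  have h := partialQuotient_add_remainder hα k
  have h1 := (one_lt_inv₀ (remainder_pos hα k)).2 (remainder_lt_one hα k)
  have h2 := remainder_lt_one hα (k + 1)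
  by_contra! hlt
  have : partialQuotient α (k + 1) = 0 := by omega
  rw [this] at h
  push_cast at h
  linarith

end Remainder

/-- The denominators of the convergents of `α`. -/
noncomputable def convDen (α : ℝ) : ℕ → ℕ
  | 0 => 1
  | 1 => partialQuotient α 1
  | k + 2 => partialQuotient α (k + 2) * convDen α (k + 1) + convDen α k

/-- The numerators of the convergents of a number `α` between `0` and `1`. -/
noncomputable def convNum (α : ℝ) : ℕ → ℤ
  | 0 => 0
  | 1 => 1
  | k + 2 => partialQuotient α (k + 2) * convNum α (k + 1) + convNum α k

/-- The distance of `q_k α` to `p_k`, where `p_k / q_k` is the `k`-th convergent. -/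
noncomputable def convErr (α : ℝ) (k : ℕ) : ℝ := (-1) ^ k * (convDen α k * α - convNum α k)

section Convergents

variable {α : ℝ}

lemma convErr_zero : convErr α 0 = α := by simp [convErr, convDen, convNum]

lemma convErr_one : convErr α 1 = 1 - partialQuotient α 1 * α := by
  simp [convErr, convDen, convNum]

lemma convErr_add_two (k : ℕ) :
    convErr α (k + 2) = convErr α k - partialQuotient α (k + 2) * convErr α (k + 1) := by
  simp only [convErr, convDen, convNum]
  push_cast
  ring

lemma convErr_succ (hα : Irrational α) (h0 : 0 < α) (h1 : α < 1) (k : ℕ) :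
    convErr α (k + 1) = convErr α k * remainder α (k + 1) := by
  induction k with
  | zero =>
    have h := partialQuotient_add_remainder hα 0
    rw [remainder_zero h0 h1] at h
    rw [convErr_zero, convErr_one, eq_sub_iff_add_eq'.2 h]
    field_simp
  | succ k ih =>
    have h := partialQuotient_add_remainder hα (k + 1)
    have hp := (remainder_pos hα (k + 1)).ne'
    rw [convErr_add_two, eq_sub_iff_add_eq'.2 h, ih]
    field_simp

lemma convErr_pos (hα : Irrational α) (h0 : 0 < α) (h1 : α < 1) (k : ℕ) : 0 < convErr α k := by
  induction k with
  | zero => rwa [convErr_zero]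
  | succ k ih => rw [convErr_succ hα h0 h1]; exact mul_pos ih (remainder_pos hα _)

lemma convErr_succ_lt (hα : Irrational α) (h0 : 0 < α) (h1 : α < 1) (k : ℕ) :
    convErr α (k + 1) < convErr α k := by
  rw [convErr_succ hα h0 h1]
  exact mul_lt_of_lt_one_right (convErr_pos hα h0 h1 k) (remainder_lt_one hα _)

lemma convErr_le (hα : Irrational α) (h0 : 0 < α) (h1 : α < 1) (k : ℕ) : convErr α k ≤ α := by
  induction k with
  | zero => rw [convErr_zero]
  | succ k ih => exact (convErr_succ_lt hα h0 h1 k).le.trans ih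

lemma convDen_pos (hα : Irrational α) : ∀ k, 0 < convDen α k
  | 0 => Nat.one_pos
  | 1 => one_le_partialQuotient hα 0
  | k + 2 => Nat.add_pos_right _ (convDen_pos hα k)

lemma convDen_lt_add_two (hα : Irrational α) (k : ℕ) : convDen α k < convDen α (k + 2) := by
  have := Nat.mul_pos (one_le_partialQuotient hα (k + 1)) (convDen_pos hα (k + 1))
  exact Nat.lt_add_of_pos_left this

lemma conv_det (k : ℕ) :
    (convDen α k : ℤ) * convNum α (k + 1) - convDen α (k + 1) * convNum α k = (-1) ^ k := by
  induction k with
  | zero => simp [convDen, convNum]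
  | succ k ih =>
    rw [pow_succ, ← ih, convDen, convNum]
    push_cast
    ring

/-- Consecutive convergents form a basis of ℤ² by `conv_det`, and u, v come from Cramer's rule. The
minus sign appears because their errors have opposite signs. -/
lemma exists_conv_combination (k : ℕ) (n i : ℤ) : ∃ u v : ℤ,
    n = u * convDen α k + v * convDen α (k + 1) ∧
      (-1) ^ k * (n * α - i) = u * convErr α k - v * convErr α (k + 1) := by
  have hdet := conv_det (α := α) k
  set D : ℤ := (-1) ^ k with hD
  have hDD : D * D = 1 := by rw [hD, ← mul_pow]; simp
  have hn : n = D * (n * convNum α (k + 1) - i * convDen α (k + 1)) * convDen α k +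
      D * (convDen α k * i - convNum α k * n) * convDen α (k + 1) := by
    linear_combination (-n) * hDD - n * D * hdet
  have hi : i = D * (n * convNum α (k + 1) - i * convDen α (k + 1)) * convNum α k +
      D * (convDen α k * i - convNum α k * n) * convNum α (k + 1) := by
    linear_combination (-i) * hDD - i * D * hdet
  refine ⟨_, _, hn, ?_⟩
  generalize D * (n * convNum α (k + 1) - i * convDen α (k + 1)) = u at hn hi
  generalize D * (convDen α k * i - convNum α k * n) = v at hn hi
  rw [hn, hi, convErr, convErr]
  push_cast
  ring

variable (hα : Irrational α) (h0 : 0 < α) (h1 : α < 1)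
include hα h0 h1

/-- Convergents and intermediate convergents are one-sided best approximations. -/
lemma convErr_sub_lt {k v j : ℕ} {i : ℤ} (hj : j < convDen α k + v * convDen α (k + 1))
    (hi : 0 < (-1) ^ k * (j * α - i)) :
    convErr α k - v * convErr α (k + 1) < (-1) ^ k * (j * α - i) := by
  obtain ⟨u, v', hn, he⟩ := exists_conv_combination (α := α) k j i
  push_cast at he
  rw [he] at hi ⊢
  have e0 := convErr_pos hα h0 h1 k
  have e1 := convErr_pos hα h0 h1 (k + 1)
  have q0 : (0 : ℤ) < convDen α k := by exact_mod_cast convDen_pos hα k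
  have q1 : (0 : ℤ) < convDen α (k + 1) := by exact_mod_cast convDen_pos hα (k + 1)
  by_contra! hle
  have hj' : u * convDen α k + v' * convDen α (k + 1) <
      (convDen α k : ℤ) + v * convDen α (k + 1) := by rw [← hn]; exact_mod_cast hj
  have hjnn : 0 ≤ u * convDen α k + v' * convDen α (k + 1) := by rw [← hn]; positivity
  -- If u ≤ 0, positivity of the error forces v' < 0, and then j would be negative.
  have hu : 1 ≤ u := by
    by_contra! hu
    have hv : v' < 0 := by
      by_contra! hv
      have a1 : (u : ℝ) * convErr α k ≤ 0 :=
        mul_nonpos_of_nonpos_of_nonneg (by exact_mod_cast Int.lt_add_one_iff.1 hu) e0.le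
      have a2 : 0 ≤ (v' : ℝ) * convErr α (k + 1) := mul_nonneg (by exact_mod_cast hv) e1.le
      linarith
    nlinarith
  have huR : (1 : ℝ) ≤ u := by exact_mod_cast hu
  have hv : (v : ℤ) ≤ v' := by
    by_contra! hv
    have : (v' : ℝ) + 1 ≤ v := by exact_mod_cast hv
    nlinarith
  nlinarith

/-- Convergents are best approximations. -/
lemma convErr_le_abs {k j : ℕ} (hj0 : 0 < j) (hj : j < convDen α (k + 1)) (i : ℤ) :
    convErr α k ≤ |j * α - i| := by
  obtain ⟨u, v, hn, he⟩ := exists_conv_combination (α := α) k j i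
  push_cast at he
  have habs : |(j : ℝ) * α - i| = |u * convErr α k - v * convErr α (k + 1)| := by
    rw [← he, abs_mul, abs_pow]; simp
  rw [habs]
  have e0 := convErr_pos hα h0 h1 k
  have e1 := convErr_pos hα h0 h1 (k + 1)
  have q0 : (0 : ℤ) < convDen α k := by exact_mod_cast convDen_pos hα k
  have q1 : (0 : ℤ) < convDen α (k + 1) := by exact_mod_cast convDen_pos hα (k + 1)
  have hj' : u * convDen α k + v * convDen α (k + 1) < (convDen α (k + 1) : ℤ) := by
    rw [← hn]; exact_mod_cast hj
  have hjpos : 0 < u * convDen α k + v * convDen α (k + 1) := by rw [← hn]; exact_mod_cast hj0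
  -- Since 0 < j < q_{k+1}, u is positive if v ≤ 0 and negative if v > 0; either way the two error
  -- terms reinforce each other.
  rcases le_or_gt v 0 with hv | hv
  · have hu : 1 ≤ u := by
      by_contra! hu
      nlinarith
    have huR : (1 : ℝ) ≤ u := by exact_mod_cast hu
    have hvR : (v : ℝ) ≤ 0 := by exact_mod_cast hv
    refine le_trans ?_ (le_abs_self _)
    nlinarith
  · have hu : u ≤ -1 := by
      by_contra! hu
      nlinarith
    have huR : (u : ℝ) ≤ -1 := by exact_mod_cast hu
    have hvR : (0 : ℝ) < v := by exact_mod_cast hv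
    refine le_trans ?_ (neg_le_abs _)
    nlinarith

omit h0 h1 in
lemma exists_convDen_le_lt (k n : ℕ) (hn : convDen α k ≤ n) :
    ∃ m, convDen α (k + 2 * m) ≤ n ∧ n < convDen α (k + 2 * m + 2) := by
  by_contra! h
  have key : ∀ m, convDen α (k + 2 * m) ≤ n ∧ m ≤ convDen α (k + 2 * m) := by
    intro m
    induction m with
    | zero => exact ⟨hn, Nat.zero_le _⟩
    | succ m ih =>
      have := h m ih.1
      have := convDen_lt_add_two hα (k + 2 * m)
      rw [show k + 2 * (m + 1) = k + 2 * m + 2 by ring]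
      omega
  have := key (n + 1)
  omega

/-- One-sided best approximations are convergents or intermediate convergents. -/
lemma exists_eq_of_best_oneSided {k n : ℕ} {i : ℤ} (hn : convDen α k ≤ n)
    (hi : 0 < (-1) ^ k * (n * α - i)) (hlt : (-1) ^ k * (n * α - i) < 1)
    (hbest : ∀ j : ℕ, 0 < j → j < n → ∀ i' : ℤ, 0 < (-1) ^ k * (j * α - i') →
      (-1) ^ k * (n * α - i) < (-1) ^ k * (j * α - i')) :
    ∃ m v : ℕ, v < partialQuotient α (k + 2 * m + 2) ∧
      n = convDen α (k + 2 * m) + v * convDen α (k + 2 * m + 1) ∧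
      (-1) ^ k * (n * α - i) = convErr α (k + 2 * m) - v * convErr α (k + 2 * m + 1) := by
  obtain ⟨m, hm1, hm2⟩ := exists_convDen_le_lt hα k n hn
  have hsig : (-1 : ℝ) ^ k = (-1) ^ (k + 2 * m) := by rw [pow_add, pow_mul]; simp
  rw [hsig] at hi hlt hbest ⊢
  refine ⟨m, ?_⟩
  generalize k + 2 * m = K at *
  obtain ⟨u, v, hnn, he⟩ := exists_conv_combination (α := α) K n i
  push_cast at he
  have e0 := convErr_pos hα h0 h1 K
  have e1 := convErr_pos hα h0 h1 (K + 1)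
  have q0 : (0 : ℤ) < convDen α K := by exact_mod_cast convDen_pos hα K
  have q1 : (0 : ℤ) < convDen α (K + 1) := by exact_mod_cast convDen_pos hα (K + 1)
  -- When n = q_K the two distances differ by an integer, and the bound 1 rules out a positive
  -- difference.
  have hle : (-1) ^ K * (n * α - i) ≤ convErr α K := by
    rcases hm1.eq_or_lt with h | h
    · by_contra! hlt
      have hs : ((-1 : ℝ) ^ K) * (-1) ^ K = 1 := by rw [← mul_pow]; simp
      have hN : (-1 : ℝ) ^ K * (n * α - i) - convErr α K =
          (((-1) ^ K * (convNum α K - i) : ℤ) : ℝ) := by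
        rw [convErr, ← h]; push_cast; ring
      have hN0 : (0 : ℝ) < (((-1) ^ K * (convNum α K - i) : ℤ) : ℝ) := by rw [← hN]; linarith
      have hN1 : (((-1) ^ K * (convNum α K - i) : ℤ) : ℝ) < 1 := by rw [← hN]; linarith
      have a1 : 0 < (-1) ^ K * (convNum α K - i) := by exact_mod_cast hN0
      have a2 : (-1) ^ K * (convNum α K - i) < 1 := by exact_mod_cast hN1
      omega
    · exact (hbest _ (convDen_pos hα K) h (convNum α K) e0).le
  rw [he] at hi hle
  have hq2 : u * convDen α K + v * convDen α (K + 1) <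
      (partialQuotient α (K + 2) * convDen α (K + 1) + convDen α K : ℤ) := by
    rw [← hnn]; rw [convDen] at hm2; exact_mod_cast hm2
  have hq0 : (convDen α K : ℤ) ≤ u * convDen α K + v * convDen α (K + 1) := by
    rw [← hnn]; exact_mod_cast hm1
  have e2 := convErr_pos hα h0 h1 (K + 2)
  rw [convErr_add_two] at e2
  have hu1 : 1 ≤ u := by
    by_contra! hu
    have hv : 0 < v := by
      by_contra! hv
      nlinarith
    have huR : (u : ℝ) ≤ 0 := by exact_mod_cast Int.lt_add_one_iff.1 hu
    have hvR : (0 : ℝ) < v := by exact_mod_cast hv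
    nlinarith
  have hva : v < partialQuotient α (K + 2) := by
    by_contra! hva
    nlinarith
  -- With u ≥ 2 and v ≤ a_{K+2} the error would be at least e_K + e_{K+2}, exceeding e_K.
  have hu : u = 1 := by
    by_contra hne
    have hu2 : 2 ≤ u := by omega
    have huR : (2 : ℝ) ≤ u := by exact_mod_cast hu2
    have hvR : (v : ℝ) ≤ partialQuotient α (K + 2) := by exact_mod_cast hva.le
    nlinarith
  subst hu
  have hv : 0 ≤ v := by
    by_contra! hv
    nlinarith
  lift v to ℕ using hv
  refine ⟨v, by exact_mod_cast hva, ?_, ?_⟩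
  · have : (n : ℤ) = convDen α K + v * convDen α (K + 1) := by rw [hnn]; ring
    exact_mod_cast this
  · rw [he]; push_cast; ring

end Convergents

/-! ### Words whose interval ends at 1 - α -/

/-- The words coding the orbits of the points slightly to the left of `1 - α`. -/
def IsLeftWord (α : ℝ) (w : Word) : Prop :=
  ∀ k ≤ w.length, onesCount w k = ⌈((k : ℝ) - 1) * α⌉

/-- The words coding the orbits of the points slightly to the right of `1 - α`. -/
def IsRightWord (α : ℝ) (w : Word) : Prop :=
  ∀ k ≤ w.length, onesCount w k = 1 + ⌊((k : ℝ) - 1) * α⌋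

lemma IsLeftWord.unique {α : ℝ} {u v : Word} (hu : IsLeftWord α u) (hv : IsLeftWord α v)
    (h : u.length = v.length) : u = v :=
  eq_of_onesCount_eq h fun k hk => by rw [hu k hk, hv k (h ▸ hk)]

lemma IsRightWord.unique {α : ℝ} {u v : Word} (hu : IsRightWord α u) (hv : IsRightWord α v)
    (h : u.length = v.length) : u = v :=
  eq_of_onesCount_eq h fun k hk => by rw [hu k hk, hv k (h ▸ hk)]

lemma isLeftWord_iff {α : ℝ} {w : Word} :
    IsLeftWord α w ↔ lowerEnd α w < 1 - α ∧ 1 - α ≤ upperEnd α w := by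
  rw [lowerEnd_lt_iff, le_upperEnd_iff, ← forall₂_and]
  refine forall₂_congr fun k _ => ?_
  rw [eq_comm, Int.ceil_eq_iff]
  constructor <;> rintro ⟨h1, h2⟩ <;> constructor <;> linarith

lemma isRightWord_iff {α : ℝ} {w : Word} :
    IsRightWord α w ↔ lowerEnd α w ≤ 1 - α ∧ 1 - α < upperEnd α w := by
  rw [lowerEnd_le_iff, lt_upperEnd_iff, ← forall₂_and]
  refine forall₂_congr fun k _ => ?_
  rw [eq_comm, add_comm, ← eq_sub_iff_add_eq, Int.floor_eq_iff]
  push_cast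
  constructor <;> rintro ⟨h1, h2⟩ <;> constructor <;> linarith

section Sides

variable {α : ℝ} (h0 : 0 < α) (h1 : α < 1) (c : EndpointChoice) {w : Word}
include h0 h1

omit h0 h1 in
lemma IsLeftWord.upperEnd_eq (hw : IsLeftWord α w) (hn : 1 ≤ w.length) :
    upperEnd α w = 1 - α := by
  obtain ⟨hl, hu⟩ := isLeftWord_iff.1 hw
  rcases notMem_interval (α := α) w hn 1 with h | h <;> push_cast at h <;> linarith

omit h0 h1 in
lemma IsRightWord.lowerEnd_eq (hw : IsRightWord α w) (hn : 1 ≤ w.length) :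
    lowerEnd α w = 1 - α := by
  obtain ⟨hl, hu⟩ := isRightWord_iff.1 hw
  rcases notMem_interval (α := α) w hn 1 with h | h <;> push_cast at h <;> linarith

/-- The interval ends at 1 - α and ψ moves points towards 1 - α, so only the bound of |d| by the
length remains. The candidates for the left end are 0 and the points 1 - α - (jα - i), with j one
less than the index along `w`. -/
lemma IsLeftWord.squareRootCondition_iff (hw : IsLeftWord α w) (hn : 1 ≤ w.length) :
    SquareRootCondition c α w ↔ |displacement α w| < 1 - α ∧
      ∀ j : ℕ, 0 < j → j < w.length → ∀ i : ℤ, 0 < j * α - i →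
        |displacement α w| < j * α - i := by
  have hU := hw.upperEnd_eq hn
  have hL := (isLeftWord_iff.1 hw).1
  have hL0 := lowerEnd_nonneg α w
  rw [SturmianSquareRoot.squareRootCondition_iff h0 h1, hU]
  constructor
  · rintro ⟨h, -, -⟩
    refine ⟨by linarith, fun j hj hjn i hi => ?_⟩
    rcases notMem_interval (α := α) w (k := j + 1) hjn (i + 1) with h' | h' <;>
      push_cast at h' <;> linarith
  · rintro ⟨ha, hb⟩
    refine ⟨?_, ?_, ?_⟩
    · obtain ⟨k, hk, hkL⟩ := exists_lowerEnd_eq α w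
      rcases k with _ | k
      · rw [hkL]; simpa using ha
      · rcases Nat.eq_zero_or_pos k with rfl | hk0
        -- Index 1 would require an integer strictly between 0 and 1.
        · exfalso
          rw [hkL] at hL hL0
          push_cast at hL hL0
          have a1 : (onesCount w (0 + 1) : ℝ) < ((1 : ℤ) : ℝ) := by push_cast; linarith
          have a2 : ((0 : ℤ) : ℝ) < onesCount w (0 + 1) := by push_cast; linarith
          rw [Int.cast_lt] at a1 a2
          omega
        · have := hb k hk0 hk (onesCount w (k + 1) - 1)
          rw [hkL] at hL ⊢
          push_cast at this hL ⊢
          have := this (by linarith)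
          linarith
    · have := le_max_left (lowerEnd α w) (lowerEnd α w - displacement α w)
      linarith
    · have := min_le_left (1 - α) (1 - α - displacement α w)
      linarith

/-- Mirror image: the right end is 1 or a point 1 - α + (i - jα). -/
lemma IsRightWord.squareRootCondition_iff (hw : IsRightWord α w) (hn : 1 ≤ w.length) :
    SquareRootCondition c α w ↔ |displacement α w| < α ∧
      ∀ j : ℕ, 0 < j → j < w.length → ∀ i : ℤ, 0 < i - j * α →
        |displacement α w| < i - j * α := by
  have hL := hw.lowerEnd_eq hn
  have hU := (isRightWord_iff.1 hw).2
  have hU1 := upperEnd_le_one α w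
  rw [SturmianSquareRoot.squareRootCondition_iff h0 h1, hL]
  constructor
  · rintro ⟨h, -, -⟩
    refine ⟨by linarith, fun j hj hjn i hi => ?_⟩
    rcases notMem_interval (α := α) w (k := j + 1) hjn (i + 1) with h' | h' <;>
      push_cast at h' <;> linarith
  · rintro ⟨ha, hb⟩
    refine ⟨?_, ?_, ?_⟩
    · obtain ⟨k, hk, hkU⟩ := exists_upperEnd_eq α w
      rcases k with _ | k
      · rw [hkU]; simpa using ha
      · rcases Nat.eq_zero_or_pos k with rfl | hk0
        · exfalso
          rw [hkU] at hU hU1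
          push_cast at hU hU1
          have a1 : (onesCount w (0 + 1) : ℝ) < ((1 : ℤ) : ℝ) := by push_cast; linarith
          have a2 : ((0 : ℤ) : ℝ) < onesCount w (0 + 1) := by push_cast; linarith
          rw [Int.cast_lt] at a1 a2
          omega
        · have := hb k hk0 hk (onesCount w (k + 1))
          rw [hkU] at hU ⊢
          push_cast at this hU ⊢
          have := this (by linarith)
          linarith
    · have := le_max_left (1 - α) (1 - α - displacement α w)
      linarith
    · have := min_le_left (upperEnd α w) (upperEnd α w - displacement α w)
      linarith

omit h0 h1 in
lemma eq_one_of_isPrimitive (hw : IsPrimitive w) {t p : ℕ} {P : ℤ} (hl : w.length = t * p)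
    (h : |p * α - P| < upperEnd α w - lowerEnd α w) : t = 1 :=
  hw _ t (eq_wordPow_of_abs_lt hl h)

/-- The interval of a primitive word satisfying the square root condition has `1 - α` as an
endpoint. -/
lemma isLeftWord_or_isRightWord (hα : Irrational α) (hw : IsPrimitive w) (hn : 1 ≤ w.length)
    (h : SquareRootCondition c α w) : IsLeftWord α w ∨ IsRightWord α w := by
  obtain ⟨hd, hl, hu⟩ := (squareRootCondition_iff h0 h1 c w).1 h
  have hLU : lowerEnd α w < upperEnd α w := by linarith [abs_nonneg (displacement α w)]
  have hL0 := lowerEnd_nonneg α w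
  have hU1 := upperEnd_le_one α w
  obtain ⟨hd1, hd2⟩ := abs_lt.1 hd
  rw [isLeftWord_iff, isRightWord_iff]
  have hy := notMem_interval (α := α) w hn 1
  push_cast at hy
  rw [one_mul] at hy
  rcases hy with hy | hy
  · right
    rcases hy.eq_or_lt with hy | hy
    · exact ⟨hy.ge, hy ▸ hLU⟩
    exfalso
    -- The maximum cannot be `lowerEnd α w`: halving the distance to 1 - α would leave the interval.
    -- So the displacement is at least the gap.
    have hε : lowerEnd α w - (1 - α) ≤ -displacement α w := by
      rcases max_cases (lowerEnd α w) (lowerEnd α w - displacement α w) with ⟨e, _⟩ | ⟨e, _⟩ <;>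
        rw [e] at hl <;> linarith
    obtain ⟨k, hk, hkL⟩ := exists_lowerEnd_eq α w
    rcases k with _ | k
    · simp at hkL; linarith
    rcases Nat.eq_zero_or_pos k with rfl | hk0
    · push_cast at hkL
      have a1 : (onesCount w (0 + 1) : ℝ) < ((2 : ℤ) : ℝ) := by push_cast; linarith
      have a2 : ((1 : ℤ) : ℝ) < onesCount w (0 + 1) := by push_cast; linarith
      rw [Int.cast_lt] at a1 a2
      omega
    push_cast at hkL
    rw [displacement] at hε hd1
    -- The reflection x ↦ -x turns the left end into a right end.
    obtain ⟨t, p, P, hnt, ht, hP⟩ := exists_divisor_of_gap (α := -α) (A := -upperEnd α w)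
      (B := -lowerEnd α w) hα.neg (n := w.length) (m := k) (Y := -1)
      (H := -onesCount w w.length) (M := -(onesCount w (k + 1) - 1))
      (fun k hk i => by
        rcases notMem_interval (α := α) w hk (-i) with h' | h' <;> push_cast at h'
        · right; linarith
        · left; linarith) hk0 hk
      (by push_cast; linarith) (by push_cast; linarith) (by push_cast; linarith)
      (by push_cast; linarith)
    have := eq_one_of_isPrimitive (P := -P) hw hnt (by
      rw [← abs_neg]; push_cast
      rw [show -(p * α - -(P : ℝ)) = p * -α - P by ring]; linarith)
    omega
  · left
    rcases hy.eq_or_lt with hy | hy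
    · exact ⟨hy ▸ hLU, hy.ge⟩
    exfalso
    have hε : 1 - α - upperEnd α w ≤ displacement α w := by
      rcases min_cases (upperEnd α w) (upperEnd α w - displacement α w) with ⟨e, _⟩ | ⟨e, _⟩ <;>
        rw [e] at hu <;> linarith
    obtain ⟨k, hk, hkU⟩ := exists_upperEnd_eq α w
    rcases k with _ | k
    · simp at hkU; linarith
    rcases Nat.eq_zero_or_pos k with rfl | hk0
    · push_cast at hkU
      have a1 : (onesCount w (0 + 1) : ℝ) < ((0 : ℤ) : ℝ) := by push_cast; linarith
      have a2 : ((-1 : ℤ) : ℝ) < onesCount w (0 + 1) := by push_cast; linarith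
      rw [Int.cast_lt] at a1 a2
      omega
    push_cast at hkU
    rw [displacement] at hε hd2
    obtain ⟨t, p, P, hnt, ht, hP⟩ := exists_divisor_of_gap (α := α) (A := lowerEnd α w)
      (B := upperEnd α w) hα (n := w.length) (m := k) (Y := 1)
      (H := onesCount w w.length) (M := onesCount w (k + 1))
      (fun k hk i => notMem_interval w hk i) hk0 hk
      (by push_cast; linarith) (by linarith) (by linarith) (by linarith)
    have := eq_one_of_isPrimitive hw hnt hP
    omega

end Sides

/-! ### Concatenating words from the two sides of 1 - α -/

lemma displacement_append (α : ℝ) (u v : Word) :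
    displacement α (u ++ v) = displacement α u + displacement α v := by
  rw [displacement, List.length_append, onesCount_append_add, displacement, displacement]
  push_cast
  ring

/-- Starting just left of 1 - α, the orbit after `u` is just left of 1 - α + d. By `hgap` no
discontinuity met while reading `v` separates it from the points just right of 1 - α. -/
lemma IsLeftWord.append {α : ℝ} {u v : Word} (hu : IsLeftWord α u) (hv : IsRightWord α v)
    (hpos : 0 < displacement α u)
    (hgap : ∀ k ≤ v.length, ∀ i : ℤ, ((k : ℝ) - 1) * α < i →
      displacement α u ≤ i - ((k : ℝ) - 1) * α) : IsLeftWord α (u ++ v) := by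
  refine forall_le_length_append.2 ⟨fun k hk => ?_, fun k hk => ?_⟩
  · rw [onesCount_append_of_le hk, hu k hk]
  · rw [onesCount_append_add, hv k hk, eq_comm, Int.ceil_eq_iff]
    have := hgap k hk (⌊((k : ℝ) - 1) * α⌋ + 1) (by push_cast; exact Int.lt_floor_add_one _)
    have := Int.floor_le (((k : ℝ) - 1) * α)
    rw [displacement] at *
    push_cast at *
    constructor <;> linarith

lemma IsRightWord.append {α : ℝ} {u v : Word} (hu : IsRightWord α u) (hv : IsLeftWord α v)
    (hneg : displacement α u < 0)
    (hgap : ∀ k ≤ v.length, ∀ i : ℤ, i < ((k : ℝ) - 1) * α →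
      -displacement α u ≤ ((k : ℝ) - 1) * α - i) : IsRightWord α (u ++ v) := by
  refine forall_le_length_append.2 ⟨fun k hk => ?_, fun k hk => ?_⟩
  · rw [onesCount_append_of_le hk, hu k hk]
  · rw [onesCount_append_add, hv k hk, add_comm (1 : ℤ), ← sub_eq_iff_eq_add, eq_comm,
      Int.floor_eq_iff]
    have := hgap k hk (⌈((k : ℝ) - 1) * α⌉ - 1) (by
      push_cast; linarith [Int.ceil_lt_add_one (((k : ℝ) - 1) * α)])
    have := Int.le_ceil (((k : ℝ) - 1) * α)
    rw [displacement] at *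
    push_cast at *
    constructor <;> linarith

@[simp] lemma wordPow_zero (z : Word) : wordPow z 0 = [] := rfl

lemma wordPow_succ (z : Word) (l : ℕ) : wordPow z (l + 1) = wordPow z l ++ z := by
  simp [wordPow, List.replicate_succ']

@[simp] lemma length_wordPow (z : Word) (l : ℕ) : (wordPow z l).length = l * z.length := by
  simp [wordPow]

lemma reverse_wordPow (z : Word) (l : ℕ) : (wordPow z l).reverse = wordPow z.reverse l := by
  simp [wordPow, List.reverse_flatten]

lemma displacement_append_wordPow (α : ℝ) (u v : Word) (l : ℕ) :
    displacement α (u ++ wordPow v l) = displacement α u + l * displacement α v := by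
  induction l with
  | zero => simp
  | succ l ih =>
    rw [wordPow_succ, ← List.append_assoc, displacement_append, ih]
    push_cast
    ring

/-- Each copy of `v` shrinks the displacement while it stays positive, so the gap hypothesis for `u`
serves every step. -/
lemma IsLeftWord.append_wordPow {α : ℝ} {u v : Word} (hu : IsLeftWord α u)
    (hv : IsRightWord α v) (hvneg : displacement α v < 0)
    (hgap : ∀ k ≤ v.length, ∀ i : ℤ, ((k : ℝ) - 1) * α < i →
      displacement α u ≤ i - ((k : ℝ) - 1) * α) (l : ℕ)
    (hl : 0 < displacement α u + l * displacement α v) : IsLeftWord α (u ++ wordPow v l) := by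
  induction l with
  | zero => simpa using hu
  | succ l ih =>
    push_cast at hl
    rw [wordPow_succ, ← List.append_assoc]
    have hl' : 0 < displacement α u + l * displacement α v := by linarith
    have hnp : (l : ℝ) * displacement α v ≤ 0 :=
      mul_nonpos_of_nonneg_of_nonpos l.cast_nonneg hvneg.le
    refine (ih hl').append hv (by rwa [displacement_append_wordPow]) fun k hk i hi => ?_
    rw [displacement_append_wordPow]
    linarith [hgap k hk i hi]

lemma IsRightWord.append_wordPow {α : ℝ} {u v : Word} (hu : IsRightWord α u)
    (hv : IsLeftWord α v) (hvpos : 0 < displacement α v)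
    (hgap : ∀ k ≤ v.length, ∀ i : ℤ, i < ((k : ℝ) - 1) * α →
      -displacement α u ≤ ((k : ℝ) - 1) * α - i) (l : ℕ)
    (hl : displacement α u + l * displacement α v < 0) : IsRightWord α (u ++ wordPow v l) := by
  induction l with
  | zero => simpa using hu
  | succ l ih =>
    push_cast at hl
    rw [wordPow_succ, ← List.append_assoc]
    have hl' : displacement α u + l * displacement α v < 0 := by linarith
    have hnn : 0 ≤ (l : ℝ) * displacement α v := mul_nonneg l.cast_nonneg hvpos.le
    refine (ih hl').append hv (by rwa [displacement_append_wordPow]) fun k hk i hi => ?_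
    rw [displacement_append_wordPow]
    linarith [hgap k hk i hi]

/-! ### Exchanging the first two letters -/

section Swap

lemma onesCount_swap (a b : Fin 2) (u : Word) (k : ℕ) :
    onesCount (b :: a :: u) (k + 2) = onesCount (a :: b :: u) (k + 2) := by
  simp only [onesCount, List.take_succ_cons, List.count_cons]
  push_cast
  ring

lemma onesCount_cons_one (a : Fin 2) (u : Word) : onesCount (a :: u) 1 = (a.val : ℤ) := by
  rw [onesCount_succ (a :: u) (k := 0) (by simp), onesCount_zero, zero_add]
  rfl

lemma onesCount_cons_cons_two (a b : Fin 2) (u : Word) :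
    onesCount (a :: b :: u) 2 = (a.val : ℤ) + b.val := by
  have := onesCount_succ (a :: b :: u) (k := 1) (by simp)
  rw [onesCount_cons_one] at this
  simpa using this

lemma length_swapFirstTwo : ∀ w : Word, (swapFirstTwo w).length = w.length
  | [] => rfl
  | [_] => rfl
  | _ :: _ :: _ => rfl

lemma displacement_swapFirstTwo (α : ℝ) :
    ∀ w : Word, displacement α (swapFirstTwo w) = displacement α w
  | [] => rfl
  | [_] => rfl
  | a :: b :: u => by
    simp only [displacement, swapFirstTwo, List.length_cons, onesCount_swap a b u]

variable {α : ℝ} (hα : Irrational α) (h0 : 0 < α) (h1 : α < 1)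
include hα

lemma ceil_eq_one_add_floor (k : ℕ) :
    ⌈(((k + 2 : ℕ) : ℝ) - 1) * α⌉ = 1 + ⌊(((k + 2 : ℕ) : ℝ) - 1) * α⌋ := by
  have heq : (((k + 2 : ℕ) : ℝ) - 1) = ((k + 1 : ℕ) : ℝ) := by push_cast; ring
  rw [heq, Int.ceil_eq_iff]
  have hne := natCast_mul_sub_ne_zero hα (Nat.succ_ne_zero k) ⌊((k + 1 : ℕ) : ℝ) * α⌋
  have h1 := Int.floor_le (((k + 1 : ℕ) : ℝ) * α)
  have h2 := Int.lt_floor_add_one (((k + 1 : ℕ) : ℝ) * α)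
  simp only [Int.cast_add, Int.cast_one]
  rw [add_sub_cancel_left]
  exact ⟨lt_of_le_of_ne h1 (fun h => hne (sub_eq_zero.2 h.symm)), by linarith⟩

include h0 h1

/-- The orbit of 1 - α meets the discontinuities 1 - α and 0 at times 0 and 1, and by irrationality
never again. The one-sided codings thus begin with 01 and 10 and agree afterwards. -/
lemma IsLeftWord.swapFirstTwo {w : Word} (hw : IsLeftWord α w) (hn : 2 ≤ w.length) :
    IsRightWord α (swapFirstTwo w) := by
  match w, hn with
  | a :: b :: u, _ =>
    have e1 := hw 1 (by simp)
    have e2 := hw 2 (by simp)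
    rw [onesCount_cons_one] at e1
    rw [onesCount_cons_cons_two] at e2
    have c1 : ⌈((1 : ℕ) - 1 : ℝ) * α⌉ = 0 := by simp
    have c2 : ⌈((2 : ℕ) - 1 : ℝ) * α⌉ = 1 := by
      rw [Int.ceil_eq_iff]; push_cast; constructor <;> linarith
    intro k hk
    simp only [SturmianSquareRoot.swapFirstTwo] at hk ⊢
    match k with
    | 0 =>
      have : ⌊((0 : ℕ) - 1 : ℝ) * α⌋ = -1 := by
        rw [Int.floor_eq_iff]; push_cast; constructor <;> linarith
      rw [this]; simp
    | 1 =>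
      have : ⌊((1 : ℕ) - 1 : ℝ) * α⌋ = 0 := by simp
      rw [this, onesCount_cons_one]; omega
    | k + 2 =>
      rw [onesCount_swap, hw (k + 2) (by simpa using hk), ceil_eq_one_add_floor hα]

lemma IsRightWord.swapFirstTwo {w : Word} (hw : IsRightWord α w) (hn : 2 ≤ w.length) :
    IsLeftWord α (swapFirstTwo w) := by
  match w, hn with
  | a :: b :: u, _ =>
    have e1 := hw 1 (by simp)
    have e2 := hw 2 (by simp)
    rw [onesCount_cons_one] at e1
    rw [onesCount_cons_cons_two] at e2
    have c1 : ⌊((1 : ℕ) - 1 : ℝ) * α⌋ = 0 := by simp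
    have c2 : ⌊((2 : ℕ) - 1 : ℝ) * α⌋ = 0 := by
      rw [Int.floor_eq_iff]; push_cast; constructor <;> linarith
    intro k hk
    simp only [SturmianSquareRoot.swapFirstTwo] at hk ⊢
    match k with
    | 0 =>
      have : ⌈((0 : ℕ) - 1 : ℝ) * α⌉ = 0 := by
        rw [Int.ceil_eq_iff]; push_cast; constructor <;> linarith
      rw [this]; simp
    | 1 =>
      have : ⌈((1 : ℕ) - 1 : ℝ) * α⌉ = 0 := by simp
      rw [this, onesCount_cons_one]; omega
    | k + 2 =>
      rw [onesCount_swap, hw (k + 2) (by simpa using hk), ceil_eq_one_add_floor hα]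

end Swap

/-! ### Standard and semistandard words -/

section StandardWords

variable {α : ℝ}

lemma reverse_semistandardWord (k l : ℕ) : (semistandardWord α (k + 2) l).reverse =
    (standardWord α k).reverse ++ wordPow (standardWord α (k + 1)).reverse l := by
  simp [semistandardWord, reverse_wordPow]

lemma standardWord_add_two (k : ℕ) :
    standardWord α (k + 2) = semistandardWord α (k + 2) (partialQuotient α (k + 2)) := by
  rw [standardWord, semistandardWord]; rfl

lemma semistandardWord_zero (k : ℕ) : semistandardWord α (k + 2) 0 = standardWord α k := by
  simp [semistandardWord]

variable (hα : Irrational α) (h0 : 0 < α) (h1 : α < 1 / 2)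
include hα

lemma length_standardWord : ∀ k, (standardWord α k).length = convDen α k
  | 0 => by simp [standardWord, convDen]
  | 1 => by
    have := one_le_partialQuotient hα 0
    simp only [standardWord, convDen, List.length_append, length_wordPow, List.length_singleton]
    rw [zero_add] at this
    omega
  | k + 2 => by
    simp [standardWord, convDen, length_standardWord (k + 1), length_standardWord k]

lemma length_semistandardWord (k l : ℕ) :
    (semistandardWord α (k + 2) l).length = convDen α k + l * convDen α (k + 1) := by
  simp [semistandardWord, length_standardWord hα, add_comm]

include h0 h1

/-- Extends `convErr_le_abs` to the multiples -1 and 0 of α, which occur because the orbit starts at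
-α; the case -1 uses α < 1/2. -/
lemma convErr_le_abs_of_ne {k t : ℕ} (ht : t ≤ convDen α (k + 1)) {i : ℤ}
    (hne : ((t : ℝ) - 1) * α ≠ i) : convErr α k ≤ |((t : ℝ) - 1) * α - i| := by
  have hle := convErr_le hα h0 (by linarith) k
  match t with
  | 0 =>
    rcases le_or_gt 0 i with hi | hi
    · have : (0 : ℝ) ≤ i := by exact_mod_cast hi
      refine le_trans ?_ (neg_le_abs _)
      push_cast; linarith
    · have : (i : ℝ) ≤ -1 := by exact_mod_cast Int.le_sub_one_of_lt hi
      refine le_trans ?_ (le_abs_self _)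
      push_cast; linarith
  | 1 =>
    have hi : i ≠ 0 := by rintro rfl; simp at hne
    have : (1 : ℝ) ≤ |(i : ℝ)| := by exact_mod_cast Int.one_le_abs hi
    have e : ((1 : ℕ) - 1 : ℝ) * α - i = -i := by push_cast; ring
    rw [e, abs_neg]
    linarith
  | t + 2 =>
    have := convErr_le_abs hα h0 (by linarith) (k := k) (Nat.succ_pos t) ht i
    have e : (((t + 2 : ℕ) : ℝ) - 1) = ((t + 1 : ℕ) : ℝ) := by push_cast; ring
    rw [e]
    exact this

lemma convErr_sub_pos {k l : ℕ} (hl : l ≤ partialQuotient α (k + 2)) :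
    0 < convErr α k - l * convErr α (k + 1) := by
  have e2 := convErr_pos hα h0 (by linarith) (k + 2)
  rw [convErr_add_two] at e2
  have := mul_le_mul_of_nonneg_right (Nat.cast_le (α := ℝ).2 hl)
    (convErr_pos hα h0 (by linarith) (k + 1)).le
  linarith

/-- Reversal puts the shorter word first, followed by copies of the longer one from the other side.
By best approximation no discontinuity is nearer than e_k, and each copy reduces the displacement by
e_{k+1} without changing its sign. -/
lemma standardWord_side_succ {k : ℕ}
    (hk : displacement α (standardWord α k).reverse = (-1) ^ k * convErr α k ∧
      (Even k → IsLeftWord α (standardWord α k).reverse) ∧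
      (Odd k → IsRightWord α (standardWord α k).reverse))
    (hk' : displacement α (standardWord α (k + 1)).reverse = (-1) ^ (k + 1) * convErr α (k + 1) ∧
      (Even (k + 1) → IsLeftWord α (standardWord α (k + 1)).reverse) ∧
      (Odd (k + 1) → IsRightWord α (standardWord α (k + 1)).reverse))
    {l : ℕ} (hl : l ≤ partialQuotient α (k + 2)) :
    displacement α (semistandardWord α (k + 2) l).reverse =
        (-1) ^ k * (convErr α k - l * convErr α (k + 1)) ∧
      (Even k → IsLeftWord α (semistandardWord α (k + 2) l).reverse) ∧
      (Odd k → IsRightWord α (semistandardWord α (k + 2) l).reverse) := by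
  obtain ⟨d, hL, hR⟩ := hk
  obtain ⟨d', hL', hR'⟩ := hk'
  have e1 := convErr_pos hα h0 (by linarith) (k + 1)
  have hpos := convErr_sub_pos hα h0 h1 hl
  have hlen : (standardWord α (k + 1)).reverse.length = convDen α (k + 1) := by
    rw [List.length_reverse, length_standardWord hα]
  rw [reverse_semistandardWord]
  refine ⟨?_, fun he => ?_, fun ho => ?_⟩
  · rw [displacement_append_wordPow, d, d']; ring
  · rw [he.neg_one_pow] at d
    rw [he.add_one.neg_one_pow] at d'
    refine (hL he).append_wordPow (hR' he.add_one) (by linarith) ?_ l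
      (by rw [d, d']; linarith)
    intro t ht i hi
    have := convErr_le_abs_of_ne hα h0 h1 (hlen ▸ ht) hi.ne
    rw [abs_of_neg (by linarith)] at this
    linarith
  · rw [ho.neg_one_pow] at d
    rw [ho.add_one.neg_one_pow] at d'
    refine (hR ho).append_wordPow (hL' ho.add_one) (by linarith) ?_ l
      (by rw [d, d']; linarith)
    intro t ht i hi
    have := convErr_le_abs_of_ne hα h0 h1 (hlen ▸ ht) hi.ne'
    rw [abs_of_pos (by linarith)] at this
    linarith

omit hα in
lemma isLeftWord_zero : IsLeftWord α [0] := by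
  rw [isLeftWord_iff, lowerEnd_lt_iff, le_upperEnd_iff, ← forall₂_and]
  intro k hk
  simp only [List.length_singleton] at hk
  have c0 := onesCount_cons_one 0 []
  interval_cases k
  · simp; constructor <;> linarith
  · rw [c0]; simp

omit hα in
lemma isRightWord_one : IsRightWord α [1] := by
  rw [isRightWord_iff, lowerEnd_le_iff, lt_upperEnd_iff, ← forall₂_and]
  intro k hk
  simp only [List.length_singleton] at hk
  have c0 := onesCount_cons_one 1 []
  interval_cases k
  · simp; constructor <;> linarith
  · rw [c0]; simp

lemma standardWord_side (k : ℕ) :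
    displacement α (standardWord α k).reverse = (-1) ^ k * convErr α k ∧
      (Even k → IsLeftWord α (standardWord α k).reverse) ∧
      (Odd k → IsRightWord α (standardWord α k).reverse) := by
  have d0 : displacement α [0] = α := by
    rw [displacement, List.length_singleton, onesCount_cons_one]; simp
  have d1 : displacement α [1] = α - 1 := by
    rw [displacement, List.length_singleton, onesCount_cons_one]; simp
  induction k using Nat.twoStepInduction with
  | zero =>
    simp only [standardWord, List.reverse_singleton, d0, convErr_zero]
    exact ⟨by ring, fun _ => isLeftWord_zero h0 h1, fun h => absurd h (by decide)⟩
  | one =>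
    have ha := one_le_partialQuotient hα 0
    have hrev : (standardWord α 1).reverse = [1] ++ wordPow [0] (partialQuotient α 1 - 1) := by
      simp [standardWord, reverse_wordPow]
    have hd : displacement α [1] + ((partialQuotient α 1 - 1 : ℕ) : ℝ) * displacement α [0] =
        -convErr α 1 := by
      rw [d0, d1, convErr_one, Nat.cast_sub ha]; push_cast; ring
    rw [hrev]
    refine ⟨?_, fun h => absurd h (by decide), fun _ => ?_⟩
    · rw [displacement_append_wordPow, hd]; ring
    -- The reversal of s_1 is the right word 1 followed by copies of the left word 0.
    · refine (isRightWord_one h0 h1).append_wordPow (isLeftWord_zero h0 h1) (by rwa [d0]) ?_ _ ?_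
      · intro t ht i hi
        rw [d1]
        simp only [List.length_singleton] at ht
        have hi1 : (i : ℝ) ≤ -1 := by
          have : i < 0 := by
            have : (i : ℝ) < 0 := by
              interval_cases t <;> push_cast at hi <;> linarith
            exact_mod_cast this
          exact_mod_cast Int.le_sub_one_of_lt this
        interval_cases t <;> push_cast <;> linarith
      · rw [hd]
        linarith [convErr_pos hα h0 (by linarith) 1]
  | more k ih1 ih2 =>
    have := standardWord_side_succ hα h0 h1 ih1 ih2 (le_refl _)
    rw [← standardWord_add_two, ← convErr_add_two] at this
    have hp : ∀ n : ℕ, (Even (n + 2) ↔ Even n) ∧ (Odd (n + 2) ↔ Odd n) := fun n => by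
      constructor <;> simp [parity_simps]
    rw [(hp k).1, (hp k).2, pow_add, neg_one_sq, mul_one]
    exact this

lemma semistandardWord_side {k l : ℕ} (hl : l ≤ partialQuotient α (k + 2)) :
    displacement α (semistandardWord α (k + 2) l).reverse =
        (-1) ^ k * (convErr α k - l * convErr α (k + 1)) ∧
      (Even k → IsLeftWord α (semistandardWord α (k + 2) l).reverse) ∧
      (Odd k → IsRightWord α (semistandardWord α (k + 2) l).reverse) :=
  standardWord_side_succ hα h0 h1 (standardWord_side hα h0 h1 k)
    (standardWord_side hα h0 h1 (k + 1)) hl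

lemma two_le_convDen_succ (k : ℕ) : 2 ≤ convDen α (k + 1) := by
  match k with
  | 0 =>
    have h := partialQuotient_add_remainder hα 0
    rw [remainder_zero h0 (by linarith)] at h
    have h2 := remainder_lt_one hα 1
    have h3 : 2 < α⁻¹ := by
      rw [lt_inv_comm₀ (by norm_num) h0]; linarith
    have : (1 : ℝ) < partialQuotient α 1 := by
      have e : (0 + 1 : ℕ) = 1 := rfl
      rw [e] at h
      linarith
    have : 1 < partialQuotient α 1 := by exact_mod_cast this
    exact this
  | k + 1 =>
    have := Nat.mul_pos (one_le_partialQuotient hα (k + 1)) (convDen_pos hα (k + 1))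
    have := convDen_pos hα k
    rw [convDen]
    change 1 ≤ partialQuotient α (k + 2) * convDen α (k + 1) at *
    omega

/-- Reversals of standard and semistandard words satisfy the square root condition. -/
lemma squareRootCondition_semistandardWord (c : EndpointChoice) {k l : ℕ}
    (hl : l < partialQuotient α (k + 2)) :
    SquareRootCondition c α (semistandardWord α (k + 2) l).reverse := by
  have h1' : α < 1 := by linarith
  obtain ⟨d, hL, hR⟩ := semistandardWord_side hα h0 h1 hl.le
  have hpos := convErr_sub_pos hα h0 h1 hl.le
  have hlen := length_semistandardWord hα k l
  have hq := convDen_pos hα k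
  rw [← List.length_reverse] at hlen
  have hnn : 0 ≤ l * convErr α (k + 1) :=
    mul_nonneg l.cast_nonneg (convErr_pos hα h0 h1' (k + 1)).le
  have hbest : ∀ j : ℕ, j < (semistandardWord α (k + 2) l).reverse.length → ∀ i : ℤ,
      0 < (-1) ^ k * (j * α - i) → convErr α k - l * convErr α (k + 1) < (-1) ^ k * (j * α - i) :=
    fun j hj i => convErr_sub_lt hα h0 h1' (hlen ▸ hj)
  rcases Nat.even_or_odd k with hk | hk
  · rw [hk.neg_one_pow, one_mul] at d
    rw [(hL hk).squareRootCondition_iff h0 h1' c (by omega), d, abs_of_pos hpos]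
    refine ⟨by linarith [convErr_le hα h0 h1' k], fun j _ hj i hi => ?_⟩
    have := hbest j hj i
    rw [hk.neg_one_pow, one_mul] at this
    exact this hi
  · rw [hk.neg_one_pow, neg_one_mul] at d
    rw [(hR hk).squareRootCondition_iff h0 h1' c (by omega), d, abs_neg, abs_of_pos hpos]
    refine ⟨?_, fun j _ hj i hi => ?_⟩
    -- The strict bound by α holds because an odd k is at least 1.
    · obtain ⟨k', rfl⟩ := Nat.exists_eq_succ_of_ne_zero (n := k) (by rintro rfl; simp at hk)
      linarith [convErr_le hα h0 h1' k', convErr_succ_lt hα h0 h1' k']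
    · have := hbest j hj i
      rw [hk.neg_one_pow, neg_one_mul, neg_sub] at this
      exact this hi

lemma squareRootCondition_standardWord (c : EndpointChoice) (k : ℕ) :
    SquareRootCondition c α (standardWord α k).reverse := by
  rw [← semistandardWord_zero]
  exact squareRootCondition_semistandardWord hα h0 h1 c (one_le_partialQuotient hα (k + 1))

/-- Reversals of standard words with the first two letters exchanged satisfy the square root
condition. -/
lemma squareRootCondition_swapFirstTwo (c : EndpointChoice) (k : ℕ) :
    SquareRootCondition c α (swapFirstTwo (standardWord α k).reverse) := by
  have h1' : α < 1 := by linarith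
  rcases k with _ | k
  -- The word s_0 = 0 is left unchanged by the exchange.
  · exact squareRootCondition_standardWord hα h0 h1 c 0
  obtain ⟨d, hL, hR⟩ := standardWord_side hα h0 h1 (k + 1)
  have hlen : (standardWord α (k + 1)).reverse.length = convDen α (k + 1) := by
    rw [List.length_reverse, length_standardWord hα]
  have hq := two_le_convDen_succ hα h0 h1 k
  have habs : |displacement α (swapFirstTwo (standardWord α (k + 1)).reverse)| =
      convErr α (k + 1) := by
    rw [displacement_swapFirstTwo, d, abs_mul, abs_pow,
      abs_of_pos (convErr_pos hα h0 h1' (k + 1))]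
    simp
  have hα' : convErr α (k + 1) < α :=
    (convErr_succ_lt hα h0 h1' k).trans_le (convErr_le hα h0 h1' k)
  have hn : 1 ≤ (swapFirstTwo (standardWord α (k + 1)).reverse).length := by
    rw [length_swapFirstTwo]; omega
  have hbest : ∀ j : ℕ, 0 < j → j < (swapFirstTwo (standardWord α (k + 1)).reverse).length →
      ∀ i : ℤ, convErr α (k + 1) < |j * α - i| := fun j hj hjn i =>
    (convErr_succ_lt hα h0 h1' k).trans_le
      (convErr_le_abs hα h0 h1' hj (by rwa [length_swapFirstTwo, hlen] at hjn) i)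
  rcases Nat.even_or_odd (k + 1) with hk | hk
  · rw [((hL hk).swapFirstTwo hα h0 h1' (by omega)).squareRootCondition_iff h0 h1' c hn, habs]
    refine ⟨hα', fun j hj hjn i hi => ?_⟩
    have := hbest j hj hjn i
    rwa [abs_sub_comm, abs_of_pos hi] at this
  · rw [((hR hk).swapFirstTwo hα h0 h1' (by omega)).squareRootCondition_iff h0 h1' c hn, habs]
    refine ⟨by linarith, fun j hj hjn i hi => ?_⟩
    have := hbest j hj hjn i
    rwa [abs_of_pos hi] at this

end StandardWords

/-! ### Classification of the primitive solutions -/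

section Classification

variable {α : ℝ}

lemma reverse_semistandardWord_mem {k v : ℕ} (hv : v < partialQuotient α (k + 2)) :
    (semistandardWord α (k + 2) v).reverse ∈
      List.reverse '' (standardWords α ∪ semistandardWords α) := by
  refine ⟨_, ?_, rfl⟩
  rcases Nat.eq_zero_or_pos v with rfl | hv0
  · exact Or.inl ⟨k, semistandardWord_zero k⟩
  · exact Or.inr ⟨k + 2, v, by omega, hv0, hv, rfl⟩

variable (hα : Irrational α) (h0 : 0 < α) (h1 : α < 1 / 2)
include hα h0 h1

lemma convErr_succ_lt_sub {k v : ℕ} (hv : v < partialQuotient α (k + 2)) :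
    convErr α (k + 1) < convErr α k - v * convErr α (k + 1) := by
  have := convErr_sub_pos hα h0 h1 (k := k) (l := v + 1) hv
  push_cast at this
  linarith

/-- For n < a_1 one has (n + 1)α < 1, so every integer above nα is farther than α. This supplies the
starting bound for odd convergents. -/
lemma convDen_one_le {n : ℕ} {H : ℤ} (hpos : 0 < H - n * α) (hlt : H - n * α < α) :
    convDen α 1 ≤ n := by
  by_contra! h
  have e1 := convErr_pos hα h0 (by linarith) 1
  rw [convErr_one] at e1
  have hn : ((n + 1 : ℕ) : ℝ) ≤ partialQuotient α 1 := by exact_mod_cast h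
  have := mul_le_mul_of_nonneg_right hn h0.le
  push_cast at this
  have hn0 : (0 : ℝ) ≤ n * α := mul_nonneg n.cast_nonneg h0.le
  have a1 : (H : ℝ) < (1 : ℤ) := by push_cast; linarith
  have a2 : ((0 : ℤ) : ℝ) < H := by push_cast; linarith
  rw [Int.cast_lt] at a1 a2
  omega

lemma IsLeftWord.mem_of_squareRootCondition (c : EndpointChoice) {w : Word} (hp : IsPrimitive w)
    (hn : 1 ≤ w.length) (hw : IsLeftWord α w) (h : SquareRootCondition c α w) :
    w ∈ List.reverse '' (standardWords α ∪ semistandardWords α) ∪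
        SturmianSquareRoot.swapFirstTwo '' (List.reverse '' standardWords α) := by
  have h1' : α < 1 := by linarith
  have hlong := ((SturmianSquareRoot.squareRootCondition_iff h0 h1' c w).1 h).1
  obtain ⟨hd, hbest⟩ := (hw.squareRootCondition_iff h0 h1' c hn).1 h
  have hne : displacement α w ≠ 0 := natCast_mul_sub_ne_zero hα (by omega) (onesCount w w.length)
  rcases lt_or_gt_of_ne hne with hneg | hpos
  -- Negative displacement: `hbest` compares with the opposite side, and primitivity has to supply
  -- the comparison on the same side.
  · rw [abs_of_neg hneg, displacement, neg_sub] at hd hbest hlong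
    rw [displacement, ← neg_pos, neg_sub] at hneg
    generalize hH : onesCount w w.length = H at *
    have hsmall : H - w.length * α < α := by
      rcases hn.eq_or_lt with hn1 | hn1
      · exfalso
        rw [← hn1] at hd hneg
        push_cast at hd hneg
        have a1 : (H : ℝ) < (1 : ℤ) := by push_cast; linarith
        have a2 : ((0 : ℤ) : ℝ) < H := by push_cast; linarith
        rw [Int.cast_lt] at a1 a2
        omega
      · simpa using hbest 1 Nat.one_pos hn1 0 (by simpa using h0)
    have hopp : ∀ j : ℕ, 0 < j → j < w.length → ∀ i : ℤ, 0 < i - j * α →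
        H - w.length * α < i - j * α := by
      intro j hj hjn i hi
      by_contra! hle
      obtain ⟨t, p, P, hnt, ht, hP⟩ := exists_divisor_of_best_opposite hα hbest
        ⟨j, hj, hjn, i, hi, hle⟩
      have := eq_one_of_isPrimitive hp hnt (hP.trans_lt hlong)
      omega
    have hsign : ∀ (j : ℕ) (i : ℤ), (-1 : ℝ) ^ 1 * (j * α - i) = i - j * α := fun j i => by ring
    obtain ⟨m, v, hv, hnv, he⟩ := exists_eq_of_best_oneSided hα h0 h1' (k := 1) (i := H)
      (convDen_one_le hα h0 h1 hneg hsmall) (by rw [hsign]; exact hneg)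
      (by rw [hsign]; linarith) (by simpa only [hsign] using hopp)
    rw [hsign] at he
    have hodd : Odd (1 + 2 * m) := by simp [parity_simps]
    generalize 1 + 2 * m = K at *
    -- For v ≥ 1, q_{K+1} < n is a competitor on the other side at distance e_{K+1} < |d|.
    have hv0 : v = 0 := by
      by_contra hv0
      have hcd : convDen α (K + 1) ≤ v * convDen α (K + 1) :=
        Nat.le_mul_of_pos_left _ (by omega)
      have hq := convDen_pos hα K
      have herr := convErr_pos hα h0 h1' (K + 1)
      have hlt := convErr_succ_lt_sub hα h0 h1 hv
      have hb := hbest (convDen α (K + 1)) (convDen_pos hα _) (by omega) (convNum α (K + 1))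
      have hE : convErr α (K + 1) = convDen α (K + 1) * α - convNum α (K + 1) := by
        rw [convErr, hodd.add_one.neg_one_pow, one_mul]
      rw [he] at hb
      have hb := hb (hE ▸ herr)
      linarith
    subst hv0
    obtain ⟨-, -, hR⟩ := standardWord_side hα h0 h1 K
    have hlen : (standardWord α K).reverse.length = w.length := by
      rw [List.length_reverse, length_standardWord hα, hnv]; simp
    obtain ⟨K', rfl⟩ := Nat.exists_eq_succ_of_ne_zero (n := K) (by rintro rfl; simp at hodd)
    have h2 := two_le_convDen_succ hα h0 h1 K'
    right
    refine ⟨_, ⟨_, ⟨K' + 1, rfl⟩, rfl⟩, ?_⟩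
    refine ((hR hodd).swapFirstTwo hα h0 h1' ?_).unique hw ?_
    · rw [List.length_reverse, length_standardWord hα]; exact h2
    · rw [length_swapFirstTwo, hlen]
  -- Positive displacement: `hbest` is already one-sided best approximation.
  · rw [abs_of_pos hpos, displacement] at hd hbest
    rw [displacement] at hpos
    obtain ⟨m, v, hv, hnv, -⟩ := exists_eq_of_best_oneSided hα h0 h1' (k := 0)
      (i := onesCount w w.length) (n := w.length) hn
      (by simpa using hpos) (by rw [pow_zero, one_mul]; linarith)
      (by simpa only [pow_zero, one_mul] using hbest)
    have heven : Even (0 + 2 * m) := by simp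
    left
    rw [hw.unique ((semistandardWord_side hα h0 h1 hv.le).2.1 heven) (by
      rw [List.length_reverse, length_semistandardWord hα, hnv])]
    exact reverse_semistandardWord_mem hv

lemma IsRightWord.mem_of_squareRootCondition (c : EndpointChoice) {w : Word} (hp : IsPrimitive w)
    (hn : 1 ≤ w.length) (hw : IsRightWord α w) (h : SquareRootCondition c α w) :
    w ∈ List.reverse '' (standardWords α ∪ semistandardWords α) ∪
        SturmianSquareRoot.swapFirstTwo '' (List.reverse '' standardWords α) := by
  have h1' : α < 1 := by linarith
  have hlong := ((SturmianSquareRoot.squareRootCondition_iff h0 h1' c w).1 h).1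
  obtain ⟨hd, hbest⟩ := (hw.squareRootCondition_iff h0 h1' c hn).1 h
  have hne : displacement α w ≠ 0 := natCast_mul_sub_ne_zero hα (by omega) (onesCount w w.length)
  rcases lt_or_gt_of_ne hne with hneg | hpos
  · rw [abs_of_neg hneg, displacement, neg_sub] at hd hbest
    rw [displacement, ← neg_pos, neg_sub] at hneg
    have hsign : ∀ (j : ℕ) (i : ℤ), (-1 : ℝ) ^ 1 * (j * α - i) = i - j * α := fun j i => by ring
    obtain ⟨m, v, hv, hnv, -⟩ := exists_eq_of_best_oneSided hα h0 h1' (k := 1)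
      (i := onesCount w w.length)
      (convDen_one_le hα h0 h1 hneg hd) (by rw [hsign]; exact hneg)
      (by rw [hsign]; linarith) (by simpa only [hsign] using hbest)
    have hodd : Odd (1 + 2 * m) := by simp [parity_simps]
    left
    rw [hw.unique ((semistandardWord_side hα h0 h1 hv.le).2.2 hodd) (by
      rw [List.length_reverse, length_semistandardWord hα, hnv])]
    exact reverse_semistandardWord_mem hv
  · rw [abs_of_pos hpos, displacement] at hd hbest hlong
    rw [displacement] at hpos
    generalize hH : onesCount w w.length = H at *
    have hn2 : 2 ≤ w.length := by
      by_contra! hn1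
      have hn1 : w.length = 1 := by omega
      rw [hn1] at hd hpos
      push_cast at hd hpos
      have a1 : (H : ℝ) < (1 : ℤ) := by push_cast; linarith
      have a2 : ((0 : ℤ) : ℝ) < H := by push_cast; linarith
      rw [Int.cast_lt] at a1 a2
      omega
    have hopp : ∀ j : ℕ, 0 < j → j < w.length → ∀ i : ℤ, 0 < j * α - i →
        w.length * α - H < j * α - i := by
      intro j hj hjn i hi
      by_contra! hle
      -- Negating α exchanges the two sides.
      obtain ⟨t, p, P, hnt, ht, hP⟩ := exists_divisor_of_best_opposite (α := -α) (H := -H)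
        (n := w.length) hα.neg
        (fun j hj hjn i hi => by
          have := hbest j hj hjn (-i) (by push_cast; linarith)
          push_cast at this ⊢
          linarith)
        ⟨j, hj, hjn, -i, by push_cast; linarith, by push_cast; linarith⟩
      have := eq_one_of_isPrimitive (α := α) (P := -P) hp hnt (by
        rw [← abs_neg]; push_cast at hP ⊢
        rw [show -(p * α - -(P : ℝ)) = p * -α - P by ring]; linarith)
      omega
    obtain ⟨m, v, hv, hnv, he⟩ := exists_eq_of_best_oneSided hα h0 h1' (k := 0)
      (i := H) (n := w.length) hn
      (by simpa using hpos) (by rw [pow_zero, one_mul]; linarith)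
      (by simpa only [pow_zero, one_mul] using hopp)
    rw [pow_zero, one_mul] at he
    have heven : Even (0 + 2 * m) := by simp
    generalize 0 + 2 * m = K at *
    have hv0 : v = 0 := by
      by_contra hv0
      have hcd : convDen α (K + 1) ≤ v * convDen α (K + 1) :=
        Nat.le_mul_of_pos_left _ (by omega)
      have hq := convDen_pos hα K
      have herr := convErr_pos hα h0 h1' (K + 1)
      have hlt := convErr_succ_lt_sub hα h0 h1 hv
      have hb := hbest (convDen α (K + 1)) (convDen_pos hα _) (by omega) (convNum α (K + 1))
      have hE : convErr α (K + 1) = convNum α (K + 1) - convDen α (K + 1) * α := by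
        rw [convErr, heven.add_one.neg_one_pow, neg_one_mul, neg_sub]
      rw [he] at hb
      have hb := hb (hE ▸ herr)
      linarith
    subst hv0
    obtain ⟨-, hL, -⟩ := standardWord_side hα h0 h1 K
    have hlen : (standardWord α K).reverse.length = w.length := by
      rw [List.length_reverse, length_standardWord hα, hnv]; simp
    right
    refine ⟨_, ⟨_, ⟨K, rfl⟩, rfl⟩, ?_⟩
    exact ((hL heven).swapFirstTwo hα h0 h1' (hlen ▸ hn2)).unique hw
      (by rw [length_swapFirstTwo, hlen])

end Classification

end SturmianSquareRoot

open SturmianSquareRoot in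
theorem theorem4p1 (α : ℝ) (hirr : Irrational α) (hpos : 0 < α) (hlt : α < 1 / 2)
    (c : EndpointChoice) (w : Word) (hw : IsPrimitive w) :
    SquareRootCondition c α w ↔
      w ∈ List.reverse '' (standardWords α ∪ semistandardWords α) ∪
        swapFirstTwo '' (List.reverse '' standardWords α) := by
  constructor
  · intro h
    have hn : 1 ≤ w.length := by
      by_contra! hn
      have : w = [] := List.length_eq_zero_iff.1 (by omega)
      -- The empty word is a zeroth power, hence not primitive.
      exact absurd (hw [] 0 this) (by norm_num)
    rcases isLeftWord_or_isRightWord hpos (by linarith) c hirr hw hn h with h' | h'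
    · exact h'.mem_of_squareRootCondition hirr hpos hlt c hw hn h
    · exact h'.mem_of_squareRootCondition hirr hpos hlt c hw hn h
  · rintro (⟨u, ⟨k, rfl⟩ | ⟨k, l, hk, -, hl, rfl⟩, rfl⟩ | ⟨_, ⟨u, ⟨k, rfl⟩, rfl⟩, rfl⟩)
    · exact squareRootCondition_standardWord hirr hpos hlt c k
    · obtain ⟨k, rfl⟩ := Nat.exists_eq_add_of_le' hk
      exact squareRootCondition_semistandardWord hirr hpos hlt c hl
    · exact squareRootCondition_swapFirstTwo hirr hpos hlt c k
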